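/- Let $\mathfrak l$ be a finite-dimensional complex reductive Lie algebra with one-dimensional center, put $\mathfrak h=[\mathfrak l,\mathfrak l]$, and let $W$ be a finite-dimensional faithful irreducible $\mathfrak l$-module on which the center acts nontrivially. Suppose that $\Lambda^2W$ is irreducible (or zero, which happens exactly when $\dim W=1$). Suppose moreover that $W$ is endowed with a nonzero $\mathfrak h$-invariant cubic form $C\in S^3W^*$, and that, as an $\mathfrak h$-module, $S^2W=P\oplus S$ with $P\cong W^*$ and with $S$ irreducible (or zero). For $r,t\in W$ write $C(rt)\in W^*$ for the contraction of the symmetric trilinear form $C$ with $r$ and $t$. Then there are a nondegenerate invariant symmetric bilinear form $K$ on $\mathfrak l$ and a bilinear map $\theta:W\times W^*\to\mathfrak l$, dual to the action of $\mathfrak l$ on $W$ in the sense that $K(x,\theta(u,u^*))=\langle x\cdot u,u^*\rangle$ for all $x\in\mathfrak l$, $u\in W$, $u^*\in W^*$, such that $\mathfrak g=\mathfrak l\oplus W\oplus W^*$ is a simple Lie algebra for the bracket which extends that of $\mathfrak l$ and the natural actions of $\mathfrak l$ on $W$ and $W^*$ and satisfies $[W,W]=[W^*,W^*]=0$ and $[u,u^*]=\theta(u,u^*)$.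 Furthermore there is a nonzero $\mathfrak h$-invariant cubic form $C^*\in S^3W$ on $W^*$ such that $V=\mathbb C\oplus W\oplus W^*\oplus\mathbb C$ is a simple $\mathfrak g$-module for the following action on $(\alpha,r,s^*,\beta^*)\in V$: each $x\in\mathfrak h$ acts by $$x\cdot(\alpha,r,s^*,\beta^*)=(0,\;x\cdot r,\;x\cdot s^*,\;0);$$ the element $\mathbf 1$ of the center of $\mathfrak l$ that acts on $W$ as the identity acts on the four summands of $V$ by the scalars $-\tfrac32,-\tfrac12,\tfrac12,\tfrac32$; and, for $t\in W$ and $t^*\in W^*$, $$t\cdot(\alpha,r,s^*,\beta^*)=\bigl(0,\;3\alpha t,\;C(rt),\;\tfrac12\langle t,s^*\rangle\bigr),$$ $$t^*\cdot(\alpha,r,s^*,\beta^*)=\bigl(\tfrac12\langle r,t^*\rangle,\;C^*(s^*t^*),\;3\beta^*t^*,\;0\bigr).$$ -/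

import Mathlib

open scoped TensorProduct

noncomputable section

section Squares

variable (R L M : Type*) [CommRing R] [LieRing L] [LieAlgebra R L]
  [AddCommGroup M] [Module R M] [LieRingModule L M] [LieModule R L M]

theorem tensorSwap_lie (x : L) (t : M ⊗[R] M) :
    TensorProduct.comm R M M ⁅x, t⁆ = ⁅x, TensorProduct.comm R M M t⁆ := by
  induction t using TensorProduct.induction_on with
  | zero => simp
  | tmul a b => simp [add_comm]
  | add a b ha hb => simp [ha, hb]

/-- The symmetric square of a Lie module, realised (in characteristic zero) as the submodule of
symmetric tensors in `M ⊗ M`. -/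
def symSquare : LieSubmodule R L (M ⊗[R] M) where
  carrier := {t | TensorProduct.comm R M M t = t}
  add_mem' ha hb := by
    simp only [Set.mem_ofPred_eq] at ha hb ⊢
    rw [map_add, ha, hb]
  zero_mem' := map_zero _
  smul_mem' c t ht := by
    simp only [Set.mem_ofPred_eq] at ht ⊢
    rw [map_smul, ht]
  lie_mem {x t} ht := by
    change TensorProduct.comm R M M ⁅x, t⁆ = ⁅x, t⁆
    have ht' : TensorProduct.comm R M M t = t := ht
    rw [tensorSwap_lie, ht']

/-- The exterior square of a Lie module, realised (in characteristic zero) as the submodule of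
antisymmetric tensors in `M ⊗ M`. -/
def altSquare : LieSubmodule R L (M ⊗[R] M) where
  carrier := {t | TensorProduct.comm R M M t = -t}
  add_mem' ha hb := by
    simp only [Set.mem_ofPred_eq] at ha hb ⊢
    rw [map_add, ha, hb, neg_add]
  zero_mem' := by simp
  smul_mem' c t ht := by
    simp only [Set.mem_ofPred_eq] at ht ⊢
    rw [map_smul, ht, smul_neg]
  lie_mem {x t} ht := by
    change TensorProduct.comm R M M ⁅x, t⁆ = -⁅x, t⁆
    have ht' : TensorProduct.comm R M M t = -t := ht
    rw [tensorSwap_lie, ht', lie_neg]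

end Squares

/-- The derived ideal `[L, L]`; for a reductive Lie algebra, its semisimple part. -/
abbrev derivedIdeal (L : Type*) [LieRing L] [LieAlgebra ℂ L] : LieIdeal ℂ L :=
  ⁅(⊤ : LieIdeal ℂ L), (⊤ : LieIdeal ℂ L)⁆

/-- A cubic form on `M`, given by its polarisation: a symmetric trilinear form. -/
structure CubicForm (M : Type*) [AddCommGroup M] [Module ℂ M] where
  toFun : M →ₗ[ℂ] M →ₗ[ℂ] M →ₗ[ℂ] ℂ
  symm_left : ∀ u v w, toFun u v w = toFun v u w
  symm_right : ∀ u v w, toFun u v w = toFun u w v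

/-- Invariance of a cubic form under the action of a Lie algebra. -/
def CubicForm.IsInvariant {M : Type*} [AddCommGroup M] [Module ℂ M] (C : CubicForm M)
    (L : Type*) [LieRing L] [LieAlgebra ℂ L] [LieRingModule L M] : Prop :=
  ∀ (x : L) (u v w : M),
    C.toFun ⁅x, u⁆ v w + C.toFun u ⁅x, v⁆ w + C.toFun u v ⁅x, w⁆ = 0

section Graded

variable {L W : Type*} [LieRing L] [LieAlgebra ℂ L]
  [AddCommGroup W] [Module ℂ W] [LieRingModule L W] [LieModule ℂ L W]

/-- The conditions on a bilinear map `θ : W × W* → L` under which `L ⊕ W ⊕ W*` is a Lie algebra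
for the bracket extending that of `L` and the actions of `L` on `W` and `W*`, with `W` and `W*`
abelian and `[u, f] = θ(u, f)` for `u ∈ W`, `f ∈ W*`. -/
structure IsLiePairing (θ : W →ₗ[ℂ] Module.Dual ℂ W →ₗ[ℂ] L) : Prop where
  equivariant : ∀ (x : L) (u : W) (f : Module.Dual ℂ W),
    ⁅x, θ u f⁆ = θ ⁅x, u⁆ f + θ u ⁅x, f⁆
  symm_left : ∀ (u v : W) (f : Module.Dual ℂ W), ⁅θ u f, v⁆ = ⁅θ v f, u⁆
  symm_right : ∀ (u : W) (f g : Module.Dual ℂ W), ⁅θ u f, g⁆ = ⁅θ u g, f⁆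

/-- The underlying vector space `L ⊕ W ⊕ W*` of the graded Lie algebra defined by `θ`. -/
def GradedLie (θ : W →ₗ[ℂ] Module.Dual ℂ W →ₗ[ℂ] L) (_ : IsLiePairing θ) : Type _ :=
  L × W × Module.Dual ℂ W

namespace GradedLie

variable (θ : W →ₗ[ℂ] Module.Dual ℂ W →ₗ[ℂ] L) (hθ : IsLiePairing θ)

instance : AddCommGroup (GradedLie θ hθ) :=
  inferInstanceAs (AddCommGroup (L × W × Module.Dual ℂ W))

instance : Module ℂ (GradedLie θ hθ) :=
  inferInstanceAs (Module ℂ (L × W × Module.Dual ℂ W))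

instance : LieRing (GradedLie θ hθ) where
  bracket a b :=
    (⁅a.1, b.1⁆ + θ a.2.1 b.2.2 - θ b.2.1 a.2.2,
      ⁅a.1, b.2.1⁆ - ⁅b.1, a.2.1⁆, ⁅a.1, b.2.2⁆ - ⁅b.1, a.2.2⁆)
  add_lie a b c := by
    refine Prod.ext ?_ (Prod.ext ?_ ?_)
    · change ⁅a.1 + b.1, c.1⁆ + θ (a.2.1 + b.2.1) c.2.2 - θ c.2.1 (a.2.2 + b.2.2)
        = ⁅a.1, c.1⁆ + θ a.2.1 c.2.2 - θ c.2.1 a.2.2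
          + (⁅b.1, c.1⁆ + θ b.2.1 c.2.2 - θ c.2.1 b.2.2)
      simp only [add_lie, map_add, LinearMap.add_apply]
      abel
    · change ⁅a.1 + b.1, c.2.1⁆ - ⁅c.1, a.2.1 + b.2.1⁆
        = ⁅a.1, c.2.1⁆ - ⁅c.1, a.2.1⁆ + (⁅b.1, c.2.1⁆ - ⁅c.1, b.2.1⁆)
      simp only [add_lie, lie_add]
      abel
    · change ⁅a.1 + b.1, c.2.2⁆ - ⁅c.1, a.2.2 + b.2.2⁆
        = ⁅a.1, c.2.2⁆ - ⁅c.1, a.2.2⁆ + (⁅b.1, c.2.2⁆ - ⁅c.1, b.2.2⁆)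
      simp only [add_lie, lie_add]
      abel
  lie_add a b c := by
    refine Prod.ext ?_ (Prod.ext ?_ ?_)
    · change ⁅a.1, b.1 + c.1⁆ + θ a.2.1 (b.2.2 + c.2.2) - θ (b.2.1 + c.2.1) a.2.2
        = ⁅a.1, b.1⁆ + θ a.2.1 b.2.2 - θ b.2.1 a.2.2
          + (⁅a.1, c.1⁆ + θ a.2.1 c.2.2 - θ c.2.1 a.2.2)
      simp only [lie_add, map_add, LinearMap.add_apply]
      abel
    · change ⁅a.1, b.2.1 + c.2.1⁆ - ⁅b.1 + c.1, a.2.1⁆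
        = ⁅a.1, b.2.1⁆ - ⁅b.1, a.2.1⁆ + (⁅a.1, c.2.1⁆ - ⁅c.1, a.2.1⁆)
      simp only [add_lie, lie_add]
      abel
    · change ⁅a.1, b.2.2 + c.2.2⁆ - ⁅b.1 + c.1, a.2.2⁆
        = ⁅a.1, b.2.2⁆ - ⁅b.1, a.2.2⁆ + (⁅a.1, c.2.2⁆ - ⁅c.1, a.2.2⁆)
      simp only [add_lie, lie_add]
      abel
  lie_self a := by
    refine Prod.ext ?_ (Prod.ext ?_ ?_)
    · change ⁅a.1, a.1⁆ + θ a.2.1 a.2.2 - θ a.2.1 a.2.2 = 0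
      simp
    · change ⁅a.1, a.2.1⁆ - ⁅a.1, a.2.1⁆ = 0
      simp
    · change ⁅a.1, a.2.2⁆ - ⁅a.1, a.2.2⁆ = 0
      simp
  leibniz_lie a b c := by
    obtain ⟨x, u, f⟩ := a
    obtain ⟨y, v, g⟩ := b
    obtain ⟨z, w, h⟩ := c
    refine Prod.ext ?_ (Prod.ext ?_ ?_)
    · change ⁅x, ⁅y, z⁆ + θ v h - θ w g⁆ + θ u (⁅y, h⁆ - ⁅z, g⁆) - θ (⁅y, w⁆ - ⁅z, v⁆) f
        = ⁅⁅x, y⁆ + θ u g - θ v f, z⁆ + θ (⁅x, v⁆ - ⁅y, u⁆) h - θ w (⁅x, g⁆ - ⁅y, f⁆)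
          + (⁅y, ⁅x, z⁆ + θ u h - θ w f⁆ + θ v (⁅x, h⁆ - ⁅z, f⁆) - θ (⁅x, w⁆ - ⁅z, u⁆) g)
      rw [← lie_skew (⁅x, y⁆ + θ u g - θ v f) z]
      simp only [lie_add, lie_sub, map_sub, LinearMap.sub_apply, hθ.equivariant]
      rw [leibniz_lie x y z, ← lie_skew ⁅x, y⁆ z]
      abel
    · change ⁅x, ⁅y, w⁆ - ⁅z, v⁆⁆ - ⁅⁅y, z⁆ + θ v h - θ w g, u⁆
        = ⁅⁅x, y⁆ + θ u g - θ v f, w⁆ - ⁅z, ⁅x, v⁆ - ⁅y, u⁆⁆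
          + (⁅y, ⁅x, w⁆ - ⁅z, u⁆⁆ - ⁅⁅x, z⁆ + θ u h - θ w f, v⁆)
      simp only [lie_sub, add_lie, sub_lie, lie_lie]
      rw [hθ.symm_left v u h, hθ.symm_left w u g, hθ.symm_left w v f]
      abel
    · change ⁅x, ⁅y, h⁆ - ⁅z, g⁆⁆ - ⁅⁅y, z⁆ + θ v h - θ w g, f⁆
        = ⁅⁅x, y⁆ + θ u g - θ v f, h⁆ - ⁅z, ⁅x, g⁆ - ⁅y, f⁆⁆
          + (⁅y, ⁅x, h⁆ - ⁅z, f⁆⁆ - ⁅⁅x, z⁆ + θ u h - θ w f, g⁆)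
      simp only [lie_sub, add_lie, sub_lie, lie_lie]
      rw [hθ.symm_right v h f, hθ.symm_right w g f, hθ.symm_right u h g]
      abel

instance : LieAlgebra ℂ (GradedLie θ hθ) where
  lie_smul r a b := by
    refine Prod.ext ?_ (Prod.ext ?_ ?_)
    · change ⁅a.1, r • b.1⁆ + θ a.2.1 (r • b.2.2) - θ (r • b.2.1) a.2.2
        = r • (⁅a.1, b.1⁆ + θ a.2.1 b.2.2 - θ b.2.1 a.2.2)
      simp only [lie_smul, map_smul, LinearMap.smul_apply, smul_sub, smul_add]
    · change ⁅a.1, r • b.2.1⁆ - ⁅r • b.1, a.2.1⁆ = r • (⁅a.1, b.2.1⁆ - ⁅b.1, a.2.1⁆)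
      simp only [lie_smul, smul_lie, smul_sub]
    · change ⁅a.1, r • b.2.2⁆ - ⁅r • b.1, a.2.2⁆ = r • (⁅a.1, b.2.2⁆ - ⁅b.1, a.2.2⁆)
      simp only [lie_smul, smul_lie, smul_sub]

/-- The element `x ⊕ u ⊕ f` of the graded Lie algebra. -/
def mk (x : L) (u : W) (f : Module.Dual ℂ W) : GradedLie θ hθ := (x, u, f)

end GradedLie

/-- The assertion that a `g`-module structure on `V = ℂ ⊕ W ⊕ W* ⊕ ℂ`, where `g = L ⊕ W ⊕ W*`, is
given by the explicit formulas attached to a cubic form `C` on `W` and a cubic form `C'` on `W*`.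
Here `C(t r) ∈ W*` is `C.toFun t r`, and `C'(f s) ∈ W** = W` is obtained from `C'.toFun f s`. -/
structure IsCubicAction [Module.Finite ℂ W]
    (θ : W →ₗ[ℂ] Module.Dual ℂ W →ₗ[ℂ] L) (hθ : IsLiePairing θ)
    (C : CubicForm W) (C' : CubicForm (Module.Dual ℂ W))
    [LieRingModule (GradedLie θ hθ) (ℂ × W × Module.Dual ℂ W × ℂ)] : Prop where
  /-- `[L, L]` acts naturally on `W` and `W*`, and trivially on the two lines. -/
  derived_act : ∀ x ∈ derivedIdeal L, ∀ (a : ℂ) (r : W) (s : Module.Dual ℂ W) (b : ℂ),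
    ⁅GradedLie.mk θ hθ x 0 0, (a, r, s, b)⁆ = ((0 : ℂ), ⁅x, r⁆, ⁅x, s⁆, (0 : ℂ))
  /-- The central element acting on `W ⊂ g` as the identity acts on `V` by the scalars
  `-3/2, -1/2, 1/2, 3/2`. -/
  center_act : ∃ z ∈ LieAlgebra.center ℂ L, (∀ w : W, ⁅z, w⁆ = w) ∧
    ∀ (a : ℂ) (r : W) (s : Module.Dual ℂ W) (b : ℂ),
      ⁅GradedLie.mk θ hθ z 0 0, (a, r, s, b)⁆
        = (-(3 / 2 : ℂ) * a, -(1 / 2 : ℂ) • r, (1 / 2 : ℂ) • s, (3 / 2 : ℂ) * b)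
  raise_act : ∀ (t : W) (a : ℂ) (r : W) (s : Module.Dual ℂ W) (b : ℂ),
    ⁅GradedLie.mk θ hθ 0 t 0, (a, r, s, b)⁆
      = ((0 : ℂ), (3 * a) • t, C.toFun t r, (1 / 2 : ℂ) * s t)
  lower_act : ∀ (f : Module.Dual ℂ W) (a : ℂ) (r : W) (s : Module.Dual ℂ W) (b : ℂ),
    ⁅GradedLie.mk θ hθ 0 0 f, (a, r, s, b)⁆
      = ((1 / 2 : ℂ) * f r, (Module.evalEquiv ℂ W).symm (C'.toFun f s), (3 * b) • f, (0 : ℂ))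

end Graded

end

/-!
Let `n = dim W` and let `z` be the central element of `L` acting on `W` as the identity. An
invariant form `K` on `L` can be scaled separately on `[L, L]` and on the center, so one may ask
that `K z z = 1` and that the Casimir element of `K` act on `W` as `n`. Let `T` be the action on
`W ⊗ W` of the split Casimir tensor, and `θ` the pairing dual to the action of `L` with respect
to `K`. Then `tr T = (tr z)² = n²` and `tr (T ∘ swap) = n²` as well, so `T` has trace `0` on `Λ²W`
and trace `n²` on `S²W`.

By Schur's lemma `T` vanishes on `Λ²W`; this is the symmetry of `⁅θ(u, f), v⁆` in `u` and `v`, which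
is the Jacobi identity for `L ⊕ W ⊕ W*`. On the copy `P` of `W*` in `S²W` the Casimir element of
`[L, L]` acts as on `W`, so `T` is the scalar `(3 - n) / 2`; the trace then forces `T = 3` on `S`.
Since `3 ≠ (3 - n) / 2`, the contraction with `C` kills `S` and hence is injective on `P`, so
`(3 / 2) (1 + swap) - T` vanishes on the kernel of the contraction `W ⊗ W → W*` and factors through
it. The resulting trilinear form on `W*` is `C*`, and the relation which defines it is exactly what
the bracket of `W` and `W*` needs in order to act on `V` through `θ`.

A nonzero ideal of `L ⊕ W ⊕ W*`, or a nonzero submodule of `V`, contains an eigenvector of `z`.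
The graded pieces have different eigenvalues, so this vector lies in one of them, and the actions of
`W` and `W*` carry it to every other piece.
-/

noncomputable section

section Schur

variable {k L M : Type*} [Field k] [LieRing L] [LieAlgebra k L] [AddCommGroup M] [Module k M]
  [LieRingModule L M] [LieModule k L M] [Module.Finite k M]

theorem exists_forall_apply_eq_smul_of_isIrreducible [IsAlgClosed k]
    [LieModule.IsIrreducible k L M] (f : M →ₗ⁅k,L⁆ M) : ∃ c : k, ∀ m, f m = c • m := by
  have : Nontrivial M := LieModule.nontrivial_of_isIrreducible k L M
  obtain ⟨c, hc⟩ := Module.End.exists_eigenvalue (f : M →ₗ[k] M)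
  obtain ⟨v, hv, hv0⟩ := hc.exists_hasEigenvector
  have mem_ker (m : M) : m ∈ (f - c • LieModuleHom.id).ker ↔ f m = c • m := by
    rw [LieModuleHom.mem_ker, LieModuleHom.sub_apply, LieModuleHom.smul_apply,
      LieModuleHom.id_apply, sub_eq_zero]
  have ker_eq_top : (f - c • LieModuleHom.id).ker = ⊤ := by
    refine (eq_bot_or_eq_top _).resolve_left fun h => hv0 ?_
    rw [← LieSubmodule.mem_bot (R := k) (L := L), ← h, mem_ker]
    exact Module.End.mem_eigenspace_iff.mp hv
  exact ⟨c, fun m => (mem_ker m).mp (ker_eq_top ▸ LieSubmodule.mem_top m)⟩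

theorem exists_forall_lie_eq_smul_of_mem_center [IsAlgClosed k] [LieModule.IsIrreducible k L M]
    {z : L} (hz : z ∈ LieAlgebra.center k L) : ∃ c : k, ∀ m : M, ⁅z, m⁆ = c • m := by
  have lie_comm (x : L) (m : M) : ⁅z, ⁅x, m⁆⁆ = ⁅x, ⁅z, m⁆⁆ := by
    rw [leibniz_lie x z m, (LieModule.mem_maxTrivSubmodule k L L z).mp hz x, zero_lie, zero_add]
  exact exists_forall_apply_eq_smul_of_isIrreducible
    ({ LieModule.toEnd k L M z with map_lie' := lie_comm _ _ } : M →ₗ⁅k,L⁆ M)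

theorem exists_mem_center_forall_lie_eq_self [IsAlgClosed k] [LieModule.IsIrreducible k L M]
    (h : ∃ z ∈ LieAlgebra.center k L, ∃ m : M, ⁅z, m⁆ ≠ 0) :
    ∃ z ∈ LieAlgebra.center k L, ∀ m : M, ⁅z, m⁆ = m := by
  obtain ⟨z, hz, m, hm⟩ := h
  obtain ⟨c, hc⟩ := exists_forall_lie_eq_smul_of_mem_center (M := M) hz
  have hc0 : c ≠ 0 := by
    rintro rfl
    exact hm (by rw [hc, zero_smul])
  refine ⟨c⁻¹ • z, (LieAlgebra.center k L).smul_mem _ hz, fun m => ?_⟩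
  rw [smul_lie, hc, inv_smul_smul₀ hc0]

theorem finrank_eq_one_of_isIrreducible_of_isLieAbelian [IsAlgClosed k] [IsLieAbelian L]
    [LieModule.IsIrreducible k L M] : Module.finrank k M = 1 := by
  have : Nontrivial M := LieModule.nontrivial_of_isIrreducible k L M
  obtain ⟨m, hm⟩ := exists_ne (0 : M)
  have lie_mem_span (x : L) {v : M} (hv : v ∈ k ∙ m) : ⁅x, v⁆ ∈ k ∙ m := by
    have hx : x ∈ LieAlgebra.center k L :=
      (LieAlgebra.isLieAbelian_iff_center_eq_top k L).mp ‹_› ▸ LieSubmodule.mem_top x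
    obtain ⟨c, hc⟩ := exists_forall_lie_eq_smul_of_mem_center (M := M) hx
    exact hc v ▸ (k ∙ m).smul_mem c hv
  let N : LieSubmodule k L M := { (k ∙ m) with lie_mem := lie_mem_span _ }
  have N_eq_top : N = ⊤ := (eq_bot_or_eq_top N).resolve_left fun h => hm <| by
    rw [← LieSubmodule.mem_bot (R := k) (L := L), ← h]
    exact Submodule.mem_span_singleton_self m
  rw [← finrank_top k M, ← LieSubmodule.top_toSubmodule (L := L), ← N_eq_top]
  exact finrank_span_singleton hm

end Schur

section TraceForm

variable {k L M : Type*} [Field k] [LieRing L] [LieAlgebra k L] [AddCommGroup M]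
  [Module k M] [LieRingModule L M] [LieModule k L M] [Module.Finite k M]

theorem isNilpotent_of_isNilpotent_of_isFaithful [Module.Finite k L]
    [LieModule.IsFaithful k L M] [LieModule.IsNilpotent L M] : LieRing.IsNilpotent L := by
  rw [LieAlgebra.isNilpotent_iff_forall (R := k)]
  intro x
  have nilpotent_toEnd : IsNilpotent (LieModule.toEnd k L M x) :=
    (LieModule.isNilpotent_iff_forall' (R := k)).mp inferInstance x
  let _ : LieRing (Module.End k M) := LieRing.ofAssociativeRing
  obtain ⟨n, hn⟩ := LieAlgebra.ad_nilpotent_of_nilpotent (R := k) nilpotent_toEnd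
  have toEnd_comp_ad : LieAlgebra.ad k (Module.End k M) (LieModule.toEnd k L M x) ∘ₗ
      (LieModule.toEnd k L M : L →ₗ[k] Module.End k M)
        = (LieModule.toEnd k L M : L →ₗ[k] Module.End k M) ∘ₗ LieAlgebra.ad k L x := by
    ext y : 1
    simp
  have toEnd_comp_ad_pow := Module.End.commute_pow_left_of_commute toEnd_comp_ad n
  rw [hn, LinearMap.zero_comp] at toEnd_comp_ad_pow
  refine ⟨n, LinearMap.ext fun y => (LieModule.toEnd_eq_zero_iff k L M).mp ?_⟩
  exact (LinearMap.congr_fun toEnd_comp_ad_pow y).symm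

theorem isSolvable_of_traceForm_eq_zero [CharZero k] [Module.Finite k L]
    [LieModule.IsFaithful k L M]
    (h : LieModule.traceForm k L M = 0) : LieAlgebra.IsSolvable L := by
  have := LieModule.isNilpotent_derivedSeries_of_traceForm_eq_zero h
  have : LieModule.IsFaithful k (LieAlgebra.derivedSeries k L 1) M :=
    inferInstanceAs <|
      LieModule.IsFaithful k (LieAlgebra.derivedSeries k L 1).toLieSubalgebra M
  have := isNilpotent_of_isNilpotent_of_isFaithful (k := k)
    (L := LieAlgebra.derivedSeries k L 1) (M := M)
  obtain ⟨n, hn⟩ := LieAlgebra.IsSolvable.solvable k (LieAlgebra.derivedSeries k L 1)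
  refine LieAlgebra.IsSolvable.mk (R := k) (k := n + 1) ?_
  rw [LieIdeal.derivedSeries_eq_bot_iff] at hn
  rw [LieAlgebra.derivedSeries_def, LieAlgebra.derivedSeriesOfIdeal_add]
  exact hn

theorem traceForm_nondegenerate_of_isIrreducible_of_isFaithful [CharZero k] [IsAlgClosed k]
    [Module.Finite k L] [LieModule.IsIrreducible k L M] [LieModule.IsFaithful k L M] :
    (LieModule.traceForm k L M).Nondegenerate := by
  have : Nontrivial M := LieModule.nontrivial_of_isIrreducible k L M
  obtain ⟨central_radical, mem_center_iff⟩ :=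
    LieAlgebra.hasCentralRadical_and_of_isIrreducible_of_isFaithful k L M
  let I : LieIdeal k L := LieAlgebra.InvariantForm.orthogonal (LieModule.traceForm k L M)
    (LieModule.traceForm_lieInvariant k L M) ⊤
  have mem_I {x : L} (hx : x ∈ I) (y : L) : LieModule.traceForm k L M y x = 0 :=
    (LieAlgebra.InvariantForm.mem_orthogonal _ _ _ _).mp hx y (LieSubmodule.mem_top y)
  have : LieModule.IsFaithful k I M :=
    inferInstanceAs (LieModule.IsFaithful k I.toLieSubalgebra M)
  have I_le_center : I ≤ LieAlgebra.center k L := by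
    rw [← central_radical.radical_eq_center, ← LieAlgebra.LieIdeal.solvable_iff_le_radical]
    exact isSolvable_of_traceForm_eq_zero (M := M) (LinearMap.ext₂ fun x y => mem_I y.2 x)
  refine (LieModule.traceForm_isSymm k L M).isRefl.nondegenerate_iff_separatingRight.mpr
    fun x hx => ?_
  obtain ⟨c, hc⟩ := Submodule.mem_span_singleton.mp <| (mem_center_iff x).mp <| I_le_center <|
    (LieAlgebra.InvariantForm.mem_orthogonal _ _ _ _).mpr fun y _ => hx y
  have finrank_ne_zero : (Module.finrank k M : k) ≠ 0 :=
    Nat.cast_ne_zero.mpr Module.finrank_pos.ne'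
  have trace_sq : c * (c * Module.finrank k M) = 0 := by
    have := hx x
    rwa [LieModule.traceForm_apply_apply, ← hc, LinearMap.smul_comp, LinearMap.comp_smul,
      LinearMap.id_comp, map_smul, map_smul, LinearMap.trace_id] at this
  have hc0 : c = 0 := by simpa [finrank_ne_zero] using trace_sq
  rw [← LieModule.toEnd_eq_zero_iff k L M, ← hc, hc0, zero_smul]

end TraceForm

section Center

variable {k L : Type*} [Field k] [LieRing L] [LieAlgebra k L] [Module.Finite k L]

theorem mem_lie_top_top_of_forall_mem_center {K : LinearMap.BilinForm k L} (symm : K.IsSymm)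
    (nondeg : K.Nondegenerate) (inv : K.lieInvariant L) {x : L}
    (hx : ∀ z ∈ LieAlgebra.center k L, K z x = 0) :
    x ∈ ⁅(⊤ : LieIdeal k L), (⊤ : LieIdeal k L)⁆ := by
  rw [← LieSubmodule.mem_toSubmodule,
    ← LinearMap.BilinForm.orthogonal_orthogonal nondeg symm.isRefl (LieSubmodule.toSubmodule _)]
  refine fun z hz => hx z <| (LieModule.mem_maxTrivSubmodule k L L z).mpr fun u =>
    nondeg.2 _ fun v => ?_
  have : K ⁅u, v⁆ z = 0 :=
    hz _ (LieSubmodule.lie_mem_lie (LieSubmodule.mem_top u) (LieSubmodule.mem_top v))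
  rwa [inv, neg_eq_zero] at this

end Center

section Trace

theorem trace_map_comp_comm {R M : Type*} [CommRing R] [AddCommGroup M] [Module R M]
    [Module.Free R M] [Module.Finite R M] (f g : M →ₗ[R] M) :
    LinearMap.trace R (M ⊗[R] M) (TensorProduct.map f g ∘ₗ (TensorProduct.comm R M M).toLinearMap)
      = LinearMap.trace R M (f ∘ₗ g) := by
  nontriviality R
  let e := Module.Free.chooseBasis R M
  rw [LinearMap.trace_eq_matrix_trace R (e.tensorProduct e), LinearMap.trace_eq_matrix_trace R e,
    LinearMap.toMatrix_comp e e e, Matrix.trace, Matrix.trace, Fintype.sum_prod_type]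
  refine Finset.sum_congr rfl fun i _ => ?_
  simp [Matrix.mul_apply, LinearMap.toMatrix_apply, mul_comm]

theorem trace_restrict_of_involutive {k V : Type*} [Field k] [CharZero k] [AddCommGroup V]
    [Module k V] [Module.Finite k V] {σ f : V →ₗ[k] V} (hσ : Function.Involutive σ)
    {p : Submodule k V} (hp : ∀ v, v ∈ p ↔ σ v = v) (hf : ∀ v ∈ p, f v ∈ p)
    (hfσ : ∀ v, f (σ v) = σ (f v)) :
    LinearMap.trace k p (f.restrict hf)
      = (1 / 2) * (LinearMap.trace k V f + LinearMap.trace k V (f ∘ₗ σ)) := by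
  have range_le (v : V) : ((1 / 2 : k) • (f + f ∘ₗ σ)) v ∈ p := by
    simp [hp, hfσ, hσ (f v), add_comm]
  have restrict_eq : f.restrict hf
      = ((1 / 2 : k) • (f + f ∘ₗ σ)).restrict fun v _ => range_le v := by
    ext ⟨v, hv⟩
    simp only [LinearMap.coe_restrict_apply, LinearMap.smul_apply, LinearMap.add_apply,
      LinearMap.comp_apply, (hp v).mp hv]
    module
  rw [restrict_eq, LinearMap.trace_restrict_eq_of_forall_mem p _ range_le, map_smul, map_add,
    smul_eq_mul]

theorem trace_eq_of_isCompl {k E : Type*} [Field k] [AddCommGroup E] [Module k E]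
    [Module.Finite k E] {p q : Submodule k E} (hpq : IsCompl p q) {f : E →ₗ[k] E} {a c : k}
    (hp : ∀ x ∈ p, f x = a • x) (hq : ∀ x ∈ q, f x = c • x) :
    LinearMap.trace k E f = a * Module.finrank k p + c * Module.finrank k q := by
  have trace_projection {p q : Submodule k E} (hpq : IsCompl p q) :
      LinearMap.trace k E (p.projection q hpq) = Module.finrank k p :=
    LinearMap.IsProj.trace
      ⟨p.projection_apply_mem hpq, fun _ => p.projection_apply_of_mem_left hpq⟩
  have f_eq : f = a • p.projection q hpq + c • q.projection p hpq.symm := LinearMap.ext fun x => by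
    conv_lhs => rw [← p.projection_add_projection_eq_self hpq x, map_add,
      hp _ (p.projection_apply_mem hpq x), hq _ (q.projection_apply_mem hpq.symm x)]
    rfl
  rw [f_eq, map_add, map_smul, map_smul, trace_projection, trace_projection, smul_eq_mul,
    smul_eq_mul]

theorem trace_tensorProduct_comm {R M : Type*} [CommRing R] [AddCommGroup M] [Module R M]
    [Module.Free R M] [Module.Finite R M] :
    LinearMap.trace R (M ⊗[R] M) (TensorProduct.comm R M M).toLinearMap = Module.finrank R M := by
  simpa only [TensorProduct.map_id, LinearMap.id_comp, LinearMap.trace_id] using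
    trace_map_comp_comm (R := R) (M := M) LinearMap.id LinearMap.id

end Trace

section DualPair

variable {R L ι : Type*} [CommRing R] [LieRing L] [LieAlgebra R L] [Fintype ι]

/-- Two finite families in `L` which are dual to each other with respect to the bilinear form `K`,
so that `∑ i, b i ⊗ b' i` is the Casimir tensor of `K`. -/
structure IsDualPair (K : LinearMap.BilinForm R L) (b b' : ι → L) : Prop where
  sum_left : ∀ x, ∑ i, K x (b i) • b' i = x
  sum_right : ∀ x, ∑ i, K x (b' i) • b i = x

theorem exists_isDualPair {k L : Type*} [Field k] [LieRing L] [LieAlgebra k L] [Module.Finite k L]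
    {K : LinearMap.BilinForm k L} (symm : K.IsSymm) (nondeg : K.Nondegenerate) :
    ∃ b b' : Fin (Module.finrank k L) → L, IsDualPair K b b' := by
  let b := Module.finBasis k L
  refine ⟨b, K.dualBasis nondeg b, fun x => ?_, fun x => ?_⟩
  · simpa only [LinearMap.BilinForm.dualBasis_repr_apply] using
      (K.dualBasis nondeg b).sum_repr x
  · have repr_apply (i) : b.repr x i = K x (K.dualBasis nondeg b i) := by
      rw [← K.dualBasis_dualBasis nondeg symm b, LinearMap.BilinForm.dualBasis_repr_apply,
        K.dualBasis_dualBasis nondeg symm b]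
    simpa only [repr_apply] using b.sum_repr x

variable {K : LinearMap.BilinForm R L} {b b' : ι → L}

namespace IsDualPair

section Bilinear

variable {N : Type*} [AddCommGroup N] [Module R N]

theorem sum_comm (h : IsDualPair K b b') (symm : K.IsSymm) (β : L →ₗ[R] L →ₗ[R] N) :
    ∑ i, β (b i) (b' i) = ∑ i, β (b' i) (b i) := by
  calc ∑ i, β (b i) (b' i) = ∑ i, ∑ j, K (b i) (b j) • β (b' j) (b' i) := by
        refine Finset.sum_congr rfl fun i _ => ?_
        conv_lhs => rw [← h.sum_left (b i)]
        simp only [map_sum, map_smul, LinearMap.sum_apply, LinearMap.smul_apply]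
    _ = ∑ j, ∑ i, K (b i) (b j) • β (b' j) (b' i) := Finset.sum_comm
    _ = ∑ j, β (b' j) (b j) := by
        refine Finset.sum_congr rfl fun j _ => ?_
        conv_rhs => rw [← h.sum_left (b j)]
        simp only [map_sum, map_smul, symm.eq]

theorem sum_lie (h : IsDualPair K b b') (symm : K.IsSymm) (inv : K.lieInvariant L)
    (β : L →ₗ[R] L →ₗ[R] N) (x : L) :
    ∑ i, β ⁅x, b i⁆ (b' i) = -∑ i, β (b i) ⁅x, b' i⁆ := by
  calc ∑ i, β ⁅x, b i⁆ (b' i) = ∑ i, ∑ j, K ⁅x, b i⁆ (b' j) • β (b j) (b' i) := by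
        refine Finset.sum_congr rfl fun i _ => ?_
        conv_lhs => rw [← h.sum_right ⁅x, b i⁆]
        simp only [map_sum, map_smul, LinearMap.sum_apply, LinearMap.smul_apply]
    _ = ∑ j, ∑ i, K ⁅x, b i⁆ (b' j) • β (b j) (b' i) := Finset.sum_comm
    _ = ∑ j, -β (b j) ⁅x, b' j⁆ := by
        refine Finset.sum_congr rfl fun j _ => ?_
        conv_rhs => rw [← h.sum_left ⁅x, b' j⁆]
        rw [map_sum, ← Finset.sum_neg_distrib]
        refine Finset.sum_congr rfl fun i _ => ?_
        rw [map_smul, inv, symm.eq (b i), neg_smul]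
    _ = -∑ j, β (b j) ⁅x, b' j⁆ := Finset.sum_neg_distrib _

end Bilinear

theorem sum_apply_eq_finrank [Module.Free R L] [Module.Finite R L] (h : IsDualPair K b b') :
    ∑ i, K (b i) (b' i) = Module.finrank R L := by
  have id_eq : (LinearMap.id : L →ₗ[R] L) = ∑ i, (K.flip (b' i)).smulRight (b i) :=
    LinearMap.ext fun x => by simp [h.sum_right]
  rw [← LinearMap.trace_id, id_eq, map_sum]
  exact Finset.sum_congr rfl fun i _ => by rw [LinearMap.trace_smulRight]; rfl

end IsDualPair

end DualPair

section Casimir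

variable (R M N : Type*) {L ι : Type*} [CommRing R] [LieRing L] [LieAlgebra R L] [Fintype ι]
  [AddCommGroup M] [Module R M] [LieRingModule L M] [LieModule R L M]
  [AddCommGroup N] [Module R N] [LieRingModule L N] [LieModule R L N]

/-- The action on a Lie module of the Casimir element `∑ i, b i * b' i` attached to a pair of dual
families. -/
def casimirEnd (b b' : ι → L) : M →ₗ[R] M :=
  ∑ i, LieModule.toEnd R L M (b i) ∘ₗ LieModule.toEnd R L M (b' i)

/-- The action on `M ⊗ N` of the Casimir tensor `∑ i, b i ⊗ b' i` attached to a pair of dual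
families. -/
def splitCasimir (b b' : ι → L) : M ⊗[R] N →ₗ[R] M ⊗[R] N :=
  ∑ i, TensorProduct.map (LieModule.toEnd R L M (b i)) (LieModule.toEnd R L N (b' i))

variable {R M N} {b b' : ι → L}

theorem casimirEnd_apply (m : M) : casimirEnd R M b b' m = ∑ i, ⁅b i, ⁅b' i, m⁆⁆ := by
  simp [casimirEnd]

theorem splitCasimir_tmul (m : M) (n : N) :
    splitCasimir R M N b b' (m ⊗ₜ n) = ∑ i, ⁅b i, m⁆ ⊗ₜ[R] ⁅b' i, n⁆ := by
  simp [splitCasimir]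

theorem trace_splitCasimir_comp_comm [Module.Free R M] [Module.Finite R M] :
    LinearMap.trace R (M ⊗[R] M)
      (splitCasimir R M M b b' ∘ₗ (TensorProduct.comm R M M).toLinearMap)
        = LinearMap.trace R M (casimirEnd R M b b') := by
  have sum_comp : splitCasimir R M M b b' ∘ₗ (TensorProduct.comm R M M).toLinearMap
      = ∑ i, TensorProduct.map (LieModule.toEnd R L M (b i)) (LieModule.toEnd R L M (b' i))
          ∘ₗ (TensorProduct.comm R M M).toLinearMap :=
    LinearMap.ext fun t => by simp [splitCasimir]
  simp only [sum_comp, casimirEnd, map_sum, trace_map_comp_comm]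

namespace IsDualPair

variable {K : LinearMap.BilinForm R L} (h : IsDualPair K b b')
include h

theorem casimirEnd_lie (symm : K.IsSymm) (inv : K.lieInvariant L) (x : L) (m : M) :
    casimirEnd R M b b' ⁅x, m⁆ = ⁅x, casimirEnd R M b b' m⁆ := by
  have sum_lie := h.sum_lie symm inv
    (LinearMap.mk₂ R (fun u v => ⁅u, ⁅v, m⁆⁆) (by simp) (by simp) (by simp) (by simp)) x
  simp only [LinearMap.mk₂_apply] at sum_lie
  simp only [casimirEnd_apply, lie_sum, leibniz_lie x, lie_add, Finset.sum_add_distrib, sum_lie]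
  abel

theorem splitCasimir_tmul_comm (symm : K.IsSymm) (m : M) (n : N) :
    ∑ i, ⁅b i, m⁆ ⊗ₜ[R] ⁅b' i, n⁆ = ∑ i, ⁅b' i, m⁆ ⊗ₜ[R] ⁅b i, n⁆ :=
  h.sum_comm symm (LinearMap.mk₂ R (fun u v => ⁅u, m⁆ ⊗ₜ[R] ⁅v, n⁆)
    (by simp [TensorProduct.add_tmul]) (by simp [TensorProduct.smul_tmul'])
    (by simp [TensorProduct.tmul_add]) (by simp))

theorem splitCasimir_comm (symm : K.IsSymm) (t : M ⊗[R] N) :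
    splitCasimir R N M b b' (TensorProduct.comm R M N t)
      = TensorProduct.comm R M N (splitCasimir R M N b b' t) := by
  induction t using TensorProduct.induction_on with
  | zero => simp only [map_zero]
  | add s t hs ht => simp only [map_add, hs, ht]
  | tmul m n =>
    simp only [splitCasimir_tmul, TensorProduct.comm_tmul, map_sum, h.splitCasimir_tmul_comm symm n]

theorem casimirEnd_tensorProduct (symm : K.IsSymm) (t : M ⊗[R] N) :
    casimirEnd R (M ⊗[R] N) b b' t
      = (casimirEnd R M b b').rTensor N t + (casimirEnd R N b b').lTensor M t
        + (2 : R) • splitCasimir R M N b b' t := by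
  induction t using TensorProduct.induction_on with
  | zero => simp only [map_zero, smul_zero, add_zero]
  | add s t hs ht => simp only [map_add, hs, ht, smul_add]; abel
  | tmul m n =>
    rw [two_smul]
    nth_rewrite 2 [splitCasimir_tmul]
    rw [h.splitCasimir_tmul_comm symm]
    simp only [casimirEnd_apply, splitCasimir_tmul, TensorProduct.LieModule.lie_tmul_right, lie_add,
      Finset.sum_add_distrib, LinearMap.rTensor_tmul, LinearMap.lTensor_tmul,
      TensorProduct.sum_tmul, TensorProduct.tmul_sum]
    abel

theorem casimirEnd_dual (symm : K.IsSymm) (f : Module.Dual R M) :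
    casimirEnd R (Module.Dual R M) b b' f = f ∘ₗ casimirEnd R M b b' := by
  ext m
  have := h.sum_comm symm
    (LinearMap.mk₂ R (fun u v => f ⁅u, ⁅v, m⁆⁆) (by simp) (by simp) (by simp) (by simp))
  simp only [LinearMap.mk₂_apply] at this
  simp [casimirEnd_apply, this]

theorem casimirEnd_sub_lie_lie {z : L} (hz : K z z = 1) (m : M) :
    casimirEnd R M b b' m - ⁅z, ⁅z, m⁆⁆
      = ∑ i, ⁅b i - K z (b i) • z, ⁅b' i - K z (b' i) • z, m⁆⁆ := by
  have sum_lie_left : ∑ i, K z (b i) • ⁅z, ⁅b' i, m⁆⁆ = ⁅z, ⁅z, m⁆⁆ := by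
    have := congrArg (fun y => ⁅z, ⁅y, m⁆⁆) (h.sum_left z)
    simpa only [_root_.sum_lie, lie_sum, smul_lie, lie_smul] using this
  have sum_lie_right : ∑ i, K z (b' i) • ⁅b i, ⁅z, m⁆⁆ = ⁅z, ⁅z, m⁆⁆ := by
    simp only [← smul_lie, ← _root_.sum_lie, h.sum_right]
  have sum_mul : ∑ i, K z (b' i) * K z (b i) = 1 := by
    simpa only [map_sum, map_smul, smul_eq_mul, hz] using congrArg (K z) (h.sum_right z)
  have sum_smul : ∑ i, K z (b' i) • K z (b i) • ⁅z, ⁅z, m⁆⁆ = ⁅z, ⁅z, m⁆⁆ := by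
    simp only [← mul_smul, ← Finset.sum_smul, sum_mul, one_smul]
  simp only [sub_lie, lie_sub, smul_lie, lie_smul, smul_sub, Finset.sum_sub_distrib,
    casimirEnd_apply, sum_lie_left, sum_lie_right, sum_smul]
  abel

end IsDualPair

end Casimir

section NormalizedForm

variable (k : Type*) {L : Type*} (W : Type*) [Field k] [LieRing L] [LieAlgebra k L]
  [AddCommGroup W] [Module k W] [LieRingModule L W] [LieModule k L W]

/-- The functional `x ↦ tr_W x / dim W`, which takes the value `1` on an element acting on `W` as
the identity. -/
def normalizedTrace : L →ₗ[k] k :=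
  (Module.finrank k W : k)⁻¹ • (LinearMap.trace k W ∘ₗ (LieModule.toEnd k L W : L →ₗ[k] _))

/-- The combination of the trace form of `W` and the square of `normalizedTrace`, with coefficient
`κ` on `[L, L]`, for which an element acting on `W` as the identity has square length `1`. -/
def normalizedForm (κ : k) : LinearMap.BilinForm k L :=
  κ • LieModule.traceForm k L W + (1 - κ * Module.finrank k W) •
    LinearMap.BilinForm.linMulLin (normalizedTrace k W) (normalizedTrace k W)

variable {k W}

theorem normalizedForm_apply (κ : k) (x y : L) :
    normalizedForm k W κ x y = κ * LieModule.traceForm k L W x y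
      + (1 - κ * Module.finrank k W) * (normalizedTrace k W x * normalizedTrace k W y) :=
  rfl

theorem normalizedTrace_lie (x y : L) : normalizedTrace k W ⁅x, y⁆ = 0 := by
  simp [normalizedTrace]

theorem normalizedForm_isSymm (κ : k) : (normalizedForm k W κ : LinearMap.BilinForm k L).IsSymm :=
  ⟨fun x y => by
    simp only [normalizedForm_apply, LieModule.traceForm_comm k L W x y,
      mul_comm (normalizedTrace k W x)]⟩

theorem normalizedForm_lieInvariant (κ : k) :
    (normalizedForm k W κ : LinearMap.BilinForm k L).lieInvariant L := fun x y y' => by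
  simp only [normalizedForm_apply, normalizedTrace_lie,
    LieModule.traceForm_lieInvariant k L W x y y']
  ring

section CharZero

variable [CharZero k] [Module.Finite k W] [Nontrivial W] {z : L} (hz : ∀ w : W, ⁅z, w⁆ = w)
include hz

theorem traceForm_apply_of_forall_lie_eq_self (x : L) :
    LieModule.traceForm k L W z x = Module.finrank k W * normalizedTrace k W x := by
  have toEnd_z : LieModule.toEnd k L W z = LinearMap.id := LinearMap.ext hz
  have finrank_ne_zero : (Module.finrank k W : k) ≠ 0 :=
    Nat.cast_ne_zero.mpr Module.finrank_pos.ne'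
  simp [LieModule.traceForm_apply_apply, toEnd_z, normalizedTrace, finrank_ne_zero]

theorem normalizedTrace_of_forall_lie_eq_self : normalizedTrace k W z = 1 := by
  have toEnd_z : LieModule.toEnd k L W z = LinearMap.id := LinearMap.ext hz
  have finrank_ne_zero : (Module.finrank k W : k) ≠ 0 :=
    Nat.cast_ne_zero.mpr Module.finrank_pos.ne'
  simp [normalizedTrace, toEnd_z, finrank_ne_zero]

theorem normalizedForm_apply_of_forall_lie_eq_self (κ : k) (x : L) :
    normalizedForm k W κ z x = normalizedTrace k W x := by
  rw [normalizedForm_apply, traceForm_apply_of_forall_lie_eq_self hz,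
    normalizedTrace_of_forall_lie_eq_self hz]
  ring

theorem normalizedForm_nondegenerate {κ : k} (hκ : κ ≠ 0)
    (nondeg : (LieModule.traceForm k L W).Nondegenerate) :
    (normalizedForm k W κ : LinearMap.BilinForm k L).Nondegenerate := by
  refine (normalizedForm_isSymm κ).isRefl.nondegenerate_iff_separatingRight.mpr fun x hx =>
    nondeg.2 x fun y => ?_
  have normalizedTrace_x : normalizedTrace k W x = 0 := by
    rw [← normalizedForm_apply_of_forall_lie_eq_self hz, hx]
  have := hx y
  rw [normalizedForm_apply, normalizedTrace_x, mul_zero, mul_zero, add_zero] at this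
  exact (mul_eq_zero.mp this).resolve_left hκ

theorem casimirEnd_normalizedForm_apply [IsAlgClosed k] [Module.Finite k L]
    [LieModule.IsIrreducible k L W] {ι : Type*} [Fintype ι] {b b' : ι → L} {κ : k} (hκ : κ ≠ 0)
    (hκ_finrank : κ * (Module.finrank k W * (Module.finrank k W - 1)) = Module.finrank k L - 1)
    (h : IsDualPair (normalizedForm k W κ) b b') (w : W) :
    casimirEnd k W b b' w = (Module.finrank k W : k) • w := by
  have finrank_ne_zero : (Module.finrank k W : k) ≠ 0 :=
    Nat.cast_ne_zero.mpr Module.finrank_pos.ne'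
  obtain ⟨c, hc⟩ := exists_forall_apply_eq_smul_of_isIrreducible
    ({ casimirEnd k W b b' with
      map_lie' := h.casimirEnd_lie (normalizedForm_isSymm κ) (normalizedForm_lieInvariant κ) _ _ } :
      W →ₗ⁅k,L⁆ W)
  have casimirEnd_eq : casimirEnd k W b b' = c • LinearMap.id := LinearMap.ext hc
  have trace_casimirEnd : ∑ i, LieModule.traceForm k L W (b i) (b' i) = c * Module.finrank k W := by
    have := congrArg (LinearMap.trace k W) casimirEnd_eq
    rwa [casimirEnd, map_sum, map_smul, LinearMap.trace_id, smul_eq_mul] at this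
  have sum_normalizedTrace : ∑ i, normalizedTrace k W (b i) * normalizedTrace k W (b' i) = 1 := by
    have := congrArg (normalizedTrace k W) (h.sum_left z)
    simpa only [map_sum, map_smul, smul_eq_mul, normalizedForm_apply_of_forall_lie_eq_self hz,
      normalizedTrace_of_forall_lie_eq_self hz] using this
  have sum_form := h.sum_apply_eq_finrank
  simp only [normalizedForm_apply, Finset.sum_add_distrib, ← Finset.mul_sum, trace_casimirEnd,
    sum_normalizedTrace] at sum_form
  have hcW : c = Module.finrank k W :=
    mul_left_cancel₀ (mul_ne_zero hκ finrank_ne_zero) (by linear_combination sum_form - hκ_finrank)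
  rw [← hcW]
  exact hc w

end CharZero

theorem finrank_eq_one_iff_of_isIrreducible_of_isFaithful [IsAlgClosed k] [Module.Finite k L]
    [Module.Finite k W] [LieModule.IsIrreducible k L W] [LieModule.IsFaithful k L W]
    (hcenter : Module.finrank k (LieAlgebra.center k L) = 1) :
    Module.finrank k W = 1 ↔ Module.finrank k L = 1 := by
  have center_le : Module.finrank k (LieAlgebra.center k L) ≤ Module.finrank k L :=
    Submodule.finrank_le (LieAlgebra.center k L).toSubmodule
  refine ⟨fun hW => le_antisymm ?_ (hcenter ▸ center_le), fun hL => ?_⟩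
  · calc Module.finrank k L ≤ Module.finrank k (Module.End k W) :=
          LinearMap.finrank_le_finrank_of_injective (f := (LieModule.toEnd k L W : L →ₗ[k] _))
            (LieModule.IsFaithful.injective_toEnd (R := k) (L := L) (M := W))
      _ = 1 := by rw [Module.finrank_linearMap, hW, one_mul]
  · have center_eq_top : LieAlgebra.center k L = ⊤ :=
      (LieSubmodule.toSubmodule_eq_top _).mp
        (Submodule.eq_top_of_finrank_eq (hcenter.trans hL.symm))
    have := (LieAlgebra.isLieAbelian_iff_center_eq_top k L).mpr center_eq_top
    exact finrank_eq_one_of_isIrreducible_of_isLieAbelian (k := k) (L := L)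

-- By comparison of traces, this is the scale at which the Casimir element acts on `W` as `dim W`.
theorem exists_ne_zero_mul_finrank_eq [CharZero k] [IsAlgClosed k] [Module.Finite k L]
    [Module.Finite k W] [LieModule.IsIrreducible k L W] [LieModule.IsFaithful k L W]
    (hcenter : Module.finrank k (LieAlgebra.center k L) = 1) :
    ∃ κ : k, κ ≠ 0 ∧
      κ * (Module.finrank k W * (Module.finrank k W - 1)) = Module.finrank k L - 1 := by
  have : Nontrivial W := LieModule.nontrivial_of_isIrreducible k L W
  have finrank_iff := finrank_eq_one_iff_of_isIrreducible_of_isFaithful (W := W) hcenter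
  by_cases hW : Module.finrank k W = 1
  · exact ⟨1, one_ne_zero, by simp [hW, finrank_iff.mp hW]⟩
  · have hL : (Module.finrank k L : k) - 1 ≠ 0 :=
      sub_ne_zero.mpr (by exact_mod_cast fun h => hW (finrank_iff.mpr h))
    have hWk : (Module.finrank k W * (Module.finrank k W - 1) : k) ≠ 0 :=
      mul_ne_zero (Nat.cast_ne_zero.mpr Module.finrank_pos.ne')
        (sub_ne_zero.mpr (by exact_mod_cast hW))
    exact ⟨_, div_ne_zero hL hWk, div_mul_cancel₀ _ hWk⟩

variable (W) in
/-- An invariant form `K` on `L` with dual families `b`, `b'`, and a central element `z` of length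
`1` spanning the orthogonal complement of `[L, L]`. The scale is such that `z` acts on `W` as the
identity and the Casimir element of `K` as `dim W`. -/
structure IsNormalizedForm {ι : Type*} [Fintype ι] (K : LinearMap.BilinForm k L) (z : L)
    (b b' : ι → L) : Prop where
  isSymm : K.IsSymm
  nondegenerate : K.Nondegenerate
  lieInvariant : K.lieInvariant L
  isDualPair : IsDualPair K b b'
  mem_center : z ∈ LieAlgebra.center k L
  lie_eq_self : ∀ w : W, ⁅z, w⁆ = w
  apply_self : K z z = 1
  mem_lie_top : ∀ x, K z x = 0 → x ∈ ⁅(⊤ : LieIdeal k L), (⊤ : LieIdeal k L)⁆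
  casimirEnd_apply : ∀ w : W, casimirEnd k W b b' w = (Module.finrank k W : k) • w

theorem exists_isNormalizedForm [CharZero k] [IsAlgClosed k] [Module.Finite k L]
    [Module.Finite k W] [LieModule.IsIrreducible k L W] [LieModule.IsFaithful k L W]
    (hcenter : Module.finrank k (LieAlgebra.center k L) = 1)
    (hnontriv : ∃ z ∈ LieAlgebra.center k L, ∃ w : W, ⁅z, w⁆ ≠ 0) :
    ∃ (K : LinearMap.BilinForm k L) (z : L) (b b' : Fin (Module.finrank k L) → L),
      IsNormalizedForm W K z b b' := by
  have : Nontrivial W := LieModule.nontrivial_of_isIrreducible k L W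
  obtain ⟨z, z_mem, hz⟩ := exists_mem_center_forall_lie_eq_self hnontriv
  obtain ⟨κ, hκ, hκ_finrank⟩ := exists_ne_zero_mul_finrank_eq (k := k) (L := L) (W := W) hcenter
  have symm := normalizedForm_isSymm (L := L) (W := W) κ
  have inv := normalizedForm_lieInvariant (L := L) (W := W) κ
  have nondeg := normalizedForm_nondegenerate hz hκ
    (traceForm_nondegenerate_of_isIrreducible_of_isFaithful (k := k) (L := L) (M := W))
  have apply_self : normalizedForm k W κ z z = 1 := by
    rw [normalizedForm_apply_of_forall_lie_eq_self hz, normalizedTrace_of_forall_lie_eq_self hz]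
  have z_ne_zero : (⟨z, z_mem⟩ : LieAlgebra.center k L) ≠ 0 := by
    rw [Ne, ← Subtype.coe_inj]
    rintro rfl
    simp at apply_self
  obtain ⟨b, b', hb⟩ := exists_isDualPair symm nondeg
  refine ⟨_, z, b, b', symm, nondeg, inv, hb, z_mem, hz, apply_self, fun x hx => ?_,
    casimirEnd_normalizedForm_apply hz hκ hκ_finrank hb⟩
  refine mem_lie_top_top_of_forall_mem_center symm nondeg inv fun y hy => ?_
  obtain ⟨c, hc⟩ := (finrank_eq_one_iff_of_nonzero' _ z_ne_zero).mp hcenter ⟨y, hy⟩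
  have smul_z : c • z = y := congrArg Subtype.val hc
  rw [← smul_z, map_smul, LinearMap.smul_apply, hx, smul_zero]

end NormalizedForm

section GradingElement

variable {R L M : Type*} [CommRing R] [LieRing L] [LieAlgebra R L] [AddCommGroup M] [Module R M]
  [LieRingModule L M] [LieModule R L M] {z : L} (hz : ∀ m : M, ⁅z, m⁆ = m)
include hz

theorem dual_lie_eq_neg_of_lie_eq_self (f : Module.Dual R M) : ⁅z, f⁆ = -f :=
  LinearMap.ext fun m => by rw [Module.Dual.lie_apply, hz, LinearMap.neg_apply]

variable (R) in
theorem lie_eq_zero_of_lie_eq_self [LieModule.IsFaithful R L M] (x : L) : ⁅z, x⁆ = 0 :=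
  LieModule.ext_of_isFaithful (R := R) (M := M) fun m => by
    rw [lie_lie, hz, hz, sub_self, zero_lie]

end GradingElement

section NormalizedSplitCasimir

variable {k L W ι : Type*} [Field k] [LieRing L] [LieAlgebra k L] [AddCommGroup W] [Module k W]
  [LieRingModule L W] [LieModule k L W] [Fintype ι] {K : LinearMap.BilinForm k L} {z : L}
  {b b' : ι → L}

namespace IsNormalizedForm

variable (h : IsNormalizedForm W K z b b')
include h

theorem apply_lie (x y : L) : K z ⁅x, y⁆ = 0 := by
  rw [h.isSymm.eq, h.lieInvariant, (LieModule.mem_maxTrivSubmodule k L L z).mp h.mem_center x,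
    map_zero, neg_zero]

theorem sub_smul_mem_lie_top (x : L) :
    x - K z x • z ∈ ⁅(⊤ : LieIdeal k L), (⊤ : LieIdeal k L)⁆ :=
  h.mem_lie_top _ (by simp [h.apply_self])

theorem lie_tensorProduct (t : W ⊗[k] W) : ⁅z, t⁆ = (2 : k) • t := by
  induction t using TensorProduct.induction_on with
  | zero => simp
  | add s t hs ht => rw [lie_add, hs, ht, smul_add]
  | tmul u v => simp [h.lie_eq_self, two_smul]

theorem lie_mem_of_forall_lie_top_lie_mem {M : Type*} [AddCommGroup M] [Module k M]
    [LieRingModule L M] [LieModule k L M] {p : Submodule k M}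
    (hp : ∀ x ∈ ⁅(⊤ : LieIdeal k L), (⊤ : LieIdeal k L)⁆, ∀ m ∈ p, ⁅x, m⁆ ∈ p)
    (hz : ∀ m ∈ p, ⁅z, m⁆ ∈ p) (x : L) {m : M} (hm : m ∈ p) : ⁅x, m⁆ ∈ p := by
  rw [← sub_add_cancel x (K z x • z), add_lie, smul_lie]
  exact p.add_mem (hp _ (h.sub_smul_mem_lie_top x) m hm) (p.smul_mem _ (hz m hm))

theorem trace_toEnd [Module.Finite k W] (x : L) :
    LinearMap.trace k W (LieModule.toEnd k L W x) = Module.finrank k W * K z x := by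
  have toEnd_z : LieModule.toEnd k L W z = LinearMap.id := LinearMap.ext h.lie_eq_self
  have trace_derived : LinearMap.trace k W (LieModule.toEnd k L W (x - K z x • z)) = 0 :=
    LieModule.trace_toEnd_eq_zero_of_mem_lcs k L W le_rfl
      (by simpa using h.sub_smul_mem_lie_top x)
  rw [map_sub, map_sub, map_smul, map_smul, toEnd_z, LinearMap.trace_id,
    sub_eq_zero] at trace_derived
  rw [trace_derived, smul_eq_mul, mul_comm]

theorem casimirEnd_eq : casimirEnd k W b b' = (Module.finrank k W : k) • LinearMap.id :=
  LinearMap.ext h.casimirEnd_apply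

theorem trace_splitCasimir [Module.Finite k W] :
    LinearMap.trace k (W ⊗[k] W) (splitCasimir k W W b b') = (Module.finrank k W : k) ^ 2 := by
  have sum_mul : ∑ i, K z (b i) * K z (b' i) = 1 := by
    simpa only [map_sum, map_smul, smul_eq_mul, h.apply_self] using
      congrArg (K z) (h.isDualPair.sum_left z)
  calc LinearMap.trace k (W ⊗[k] W) (splitCasimir k W W b b')
      = ∑ i, (Module.finrank k W : k) ^ 2 * (K z (b i) * K z (b' i)) := by
        rw [splitCasimir, map_sum]
        refine Finset.sum_congr rfl fun i _ => ?_
        rw [LinearMap.trace_tensorProduct', h.trace_toEnd, h.trace_toEnd]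
        ring
    _ = (Module.finrank k W : k) ^ 2 := by rw [← Finset.mul_sum, sum_mul, mul_one]

theorem trace_splitCasimir_comp_comm [Module.Finite k W] :
    LinearMap.trace k (W ⊗[k] W)
      (splitCasimir k W W b b' ∘ₗ (TensorProduct.comm k W W).toLinearMap)
        = (Module.finrank k W : k) ^ 2 := by
  rw [_root_.trace_splitCasimir_comp_comm, h.casimirEnd_eq, map_smul, LinearMap.trace_id,
    smul_eq_mul, sq]

theorem casimirEnd_tensorProduct (t : W ⊗[k] W) :
    casimirEnd k (W ⊗[k] W) b b' t
      = (2 : k) • splitCasimir k W W b b' t + (2 * Module.finrank k W : k) • t := by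
  rw [h.isDualPair.casimirEnd_tensorProduct h.isSymm, h.casimirEnd_eq, LinearMap.rTensor_smul,
    LinearMap.lTensor_smul, LinearMap.smul_apply, LinearMap.smul_apply, LinearMap.rTensor_id_apply,
    LinearMap.lTensor_id_apply]
  module

theorem casimirEnd_dual (f : Module.Dual k W) :
    casimirEnd k (Module.Dual k W) b b' f = (Module.finrank k W : k) • f := by
  rw [h.isDualPair.casimirEnd_dual h.isSymm, h.casimirEnd_eq, LinearMap.comp_smul,
    LinearMap.comp_id]

variable [CharZero k]

theorem splitCasimir_lie (x : L) (t : W ⊗[k] W) :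
    splitCasimir k W W b b' ⁅x, t⁆ = ⁅x, splitCasimir k W W b b' t⁆ := by
  have := h.isDualPair.casimirEnd_lie h.isSymm h.lieInvariant x t
  rw [h.casimirEnd_tensorProduct, h.casimirEnd_tensorProduct, lie_add, lie_smul, lie_smul,
    add_left_inj] at this
  exact smul_right_injective _ (two_ne_zero (α := k)) this

theorem splitCasimir_eq_sum_lie_lie (t : W ⊗[k] W) :
    splitCasimir k W W b b' t
      = (1 / 2 : k) • ∑ i, ⁅b i - K z (b i) • z, ⁅b' i - K z (b' i) • z, t⁆⁆
        + (2 - Module.finrank k W : k) • t := by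
  rw [← h.isDualPair.casimirEnd_sub_lie_lie h.apply_self, h.casimirEnd_tensorProduct,
    h.lie_tensorProduct, h.lie_tensorProduct]
  module

omit [CharZero k] in
theorem sum_lie_lie_dual (f : Module.Dual k W) :
    ∑ i, ⁅b i - K z (b i) • z, ⁅b' i - K z (b' i) • z, f⁆⁆ = (Module.finrank k W - 1 : k) • f := by
  rw [← h.isDualPair.casimirEnd_sub_lie_lie h.apply_self, h.casimirEnd_dual,
    dual_lie_eq_neg_of_lie_eq_self h.lie_eq_self, dual_lie_eq_neg_of_lie_eq_self h.lie_eq_self]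
  module

theorem splitCasimir_mem_of_forall_lie_top_lie_mem {p : Submodule k (W ⊗[k] W)}
    (hp : ∀ x ∈ ⁅(⊤ : LieIdeal k L), (⊤ : LieIdeal k L)⁆, ∀ t ∈ p, ⁅x, t⁆ ∈ p)
    {t : W ⊗[k] W} (ht : t ∈ p) : splitCasimir k W W b b' t ∈ p := by
  rw [h.splitCasimir_eq_sum_lie_lie]
  exact p.add_mem (p.smul_mem _ (p.sum_mem fun i _ => hp _ (h.sub_smul_mem_lie_top _) _
    (hp _ (h.sub_smul_mem_lie_top _) _ ht))) (p.smul_mem _ ht)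

theorem map_splitCasimir_of_map_lie_top {φ : W ⊗[k] W →ₗ[k] Module.Dual k W}
    (hφ : ∀ x ∈ ⁅(⊤ : LieIdeal k L), (⊤ : LieIdeal k L)⁆, ∀ t, φ ⁅x, t⁆ = ⁅x, φ t⁆)
    (t : W ⊗[k] W) :
    φ (splitCasimir k W W b b' t) = ((3 - Module.finrank k W) / 2 : k) • φ t := by
  rw [h.splitCasimir_eq_sum_lie_lie, map_add, map_smul, map_smul, map_sum]
  simp only [hφ _ (h.sub_smul_mem_lie_top _), h.sum_lie_lie_dual]
  module

theorem splitCasimir_map_of_map_lie_top {ψ : Module.Dual k W →ₗ[k] W ⊗[k] W}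
    (hψ : ∀ x ∈ ⁅(⊤ : LieIdeal k L), (⊤ : LieIdeal k L)⁆, ∀ f, ψ ⁅x, f⁆ = ⁅x, ψ f⁆)
    (f : Module.Dual k W) :
    splitCasimir k W W b b' (ψ f) = ((3 - Module.finrank k W) / 2 : k) • ψ f := by
  rw [h.splitCasimir_eq_sum_lie_lie]
  simp only [← hψ _ (h.sub_smul_mem_lie_top _), ← map_sum, h.sum_lie_lie_dual, map_smul]
  module

theorem splitCasimir_eq_zero_of_mem_altSquare [IsAlgClosed k] [Module.Finite k W]
    (halt : altSquare k L W = ⊥ ∨ LieModule.IsIrreducible k L (altSquare k L W))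
    {t : W ⊗[k] W} (ht : t ∈ altSquare k L W) : splitCasimir k W W b b' t = 0 := by
  rcases halt with halt | halt
  · rw [halt, LieSubmodule.mem_bot] at ht
    rw [ht, map_zero]
  let σ : W ⊗[k] W →ₗ[k] W ⊗[k] W := -(TensorProduct.comm k W W).toLinearMap
  let T := splitCasimir k W W b b'
  have mem_iff (t : W ⊗[k] W) : t ∈ (altSquare k L W).toSubmodule ↔ σ t = t :=
    neg_eq_iff_eq_neg.symm
  have T_σ (t : W ⊗[k] W) : T (σ t) = σ (T t) := by
    simp only [σ, T, LinearMap.neg_apply, LinearEquiv.coe_coe, map_neg,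
      h.isDualPair.splitCasimir_comm h.isSymm]
  have T_mem : ∀ t ∈ (altSquare k L W).toSubmodule, T t ∈ (altSquare k L W).toSubmodule :=
    fun t ht => (mem_iff _).mpr (by rw [← T_σ, (mem_iff t).mp ht])
  have trace_T : LinearMap.trace k _ (T.restrict T_mem) = 0 := by
    have comp_σ : T ∘ₗ σ = -(T ∘ₗ (TensorProduct.comm k W W).toLinearMap) := LinearMap.comp_neg _ _
    rw [trace_restrict_of_involutive (fun t => by simp [σ]) mem_iff T_mem T_σ, comp_σ, map_neg,
      h.trace_splitCasimir, h.trace_splitCasimir_comp_comm, add_neg_cancel, mul_zero]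
  obtain ⟨c, hc⟩ := exists_forall_apply_eq_smul_of_isIrreducible
    ({ T.restrict T_mem with map_lie' := Subtype.ext (h.splitCasimir_lie _ _) } :
      altSquare k L W →ₗ⁅k,L⁆ altSquare k L W)
  have : Nontrivial (altSquare k L W) := LieModule.nontrivial_of_isIrreducible k L _
  have restrict_eq : T.restrict T_mem = c • LinearMap.id := LinearMap.ext hc
  have hc0 : c = 0 := by
    rw [restrict_eq, map_smul, LinearMap.trace_id, smul_eq_mul] at trace_T
    exact (mul_eq_zero.mp trace_T).resolve_right (Nat.cast_ne_zero.mpr Module.finrank_pos.ne')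
  rw [hc0] at hc
  exact (congrArg Subtype.val (hc ⟨t, ht⟩)).trans (zero_smul k t)

end IsNormalizedForm

end NormalizedSplitCasimir

namespace CubicForm

variable {W : Type*} [AddCommGroup W] [Module ℂ W] (C : CubicForm W)

/-- The contraction `u ⊗ v ↦ C(u v)` of a cubic form. -/
def contract : W ⊗[ℂ] W →ₗ[ℂ] Module.Dual ℂ W := TensorProduct.lift C.toFun

theorem contract_tmul (u v : W) : C.contract (u ⊗ₜ v) = C.toFun u v := rfl

theorem toFun_comm (u v : W) : C.toFun u v = C.toFun v u := LinearMap.ext (C.symm_left u v)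

theorem contract_comm (t : W ⊗[ℂ] W) :
    C.contract (TensorProduct.comm ℂ W W t) = C.contract t := by
  induction t using TensorProduct.induction_on with
  | zero => rw [map_zero]
  | add s t hs ht => rw [map_add, map_add, map_add, hs, ht]
  | tmul u v => exact C.toFun_comm v u

theorem contract_surjective [Module.Finite ℂ W] (hC : LinearMap.ker C.toFun = ⊥) :
    Function.Surjective C.contract := by
  refine LinearMap.dualMap_injective_iff.mp (LinearMap.ker_eq_bot.mp (LinearMap.ker_eq_bot'.mpr
    fun φ hφ => ?_))
  obtain ⟨w, rfl⟩ := (Module.evalEquiv ℂ W).surjective φ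
  have hw : w ∈ LinearMap.ker C.toFun := LinearMap.ext₂ fun u v => by
    rw [C.symm_left, C.symm_right]
    exact LinearMap.congr_fun hφ (u ⊗ₜ v)
  rw [(Submodule.eq_bot_iff _).mp hC w hw, map_zero]

variable {C}

theorem IsInvariant.contract_lie {L : Type*} [LieRing L] [LieAlgebra ℂ L] [LieRingModule L W]
    [LieModule ℂ L W] (inv : C.IsInvariant L) (x : L) (t : W ⊗[ℂ] W) :
    C.contract ⁅x, t⁆ = ⁅x, C.contract t⁆ := by
  induction t using TensorProduct.induction_on with
  | zero => simp only [lie_zero, map_zero]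
  | add s t hs ht => simp only [lie_add, map_add, hs, ht]
  | tmul u v =>
    ext w
    simp only [TensorProduct.LieModule.lie_tmul_right, map_add, contract_tmul,
      LinearMap.add_apply, Module.Dual.lie_apply]
    linear_combination inv x u v w

end CubicForm

section SymmetricPart

variable {L W ι : Type*} [LieRing L] [LieAlgebra ℂ L] [AddCommGroup W] [Module ℂ W]
  [LieRingModule L W] [LieModule ℂ L W] [Fintype ι] {K : LinearMap.BilinForm ℂ L} {z : L}
  {b b' : ι → L} {C : CubicForm W}

theorem two_mul_finrank_symSquare (L : Type*) [LieRing L] [LieAlgebra ℂ L] [LieRingModule L W]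
    [LieModule ℂ L W] [Module.Finite ℂ W] :
    2 * (Module.finrank ℂ (symSquare ℂ L W) : ℂ)
      = (Module.finrank ℂ W : ℂ) ^ 2 + Module.finrank ℂ W := by
  have trace_id := trace_restrict_of_involutive
    (σ := (TensorProduct.comm ℂ W W).toLinearMap) (f := LinearMap.id)
    (p := (symSquare ℂ L W).toSubmodule) (TensorProduct.comm_comm ℂ W W) (fun t => Iff.rfl)
    (fun _ ht => ht) fun _ => rfl
  have restrict_id : (LinearMap.id : W ⊗[ℂ] W →ₗ[ℂ] W ⊗[ℂ] W).restrict
      (p := (symSquare ℂ L W).toSubmodule) (fun _ ht => ht) = LinearMap.id := rfl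
  rw [restrict_id, LinearMap.id_comp, LinearMap.trace_id, LinearMap.trace_id,
    trace_tensorProduct_comm, Module.finrank_tensorProduct, Nat.cast_mul] at trace_id
  linear_combination 2 * trace_id

namespace IsNormalizedForm

variable (h : IsNormalizedForm W K z b b')
include h

theorem ker_toFun_eq_bot [LieModule.IsIrreducible ℂ L W] (hC : C.toFun ≠ 0)
    (inv : C.IsInvariant (derivedIdeal L)) : LinearMap.ker C.toFun = ⊥ := by
  have lie_mem_of_mem_derived (x : L) (hx : x ∈ derivedIdeal L) (u : W)
      (hu : u ∈ LinearMap.ker C.toFun) : ⁅x, u⁆ ∈ LinearMap.ker C.toFun := by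
    refine LinearMap.ext₂ fun v w => ?_
    have inv_x := inv ⟨x, hx⟩ u v w
    rw [LinearMap.mem_ker] at hu
    simpa [hu] using inv_x
  let N : LieSubmodule ℂ L W :=
    { LinearMap.ker C.toFun with
      lie_mem := h.lie_mem_of_forall_lie_top_lie_mem lie_mem_of_mem_derived
        (fun u hu => by rwa [h.lie_eq_self]) _ }
  rcases eq_bot_or_eq_top N with hN | hN
  · exact congrArg LieSubmodule.toSubmodule hN
  · exact absurd (LinearMap.ker_eq_top.mp (congrArg LieSubmodule.toSubmodule hN)) hC

theorem contract_splitCasimir (inv : C.IsInvariant (derivedIdeal L)) (t : W ⊗[ℂ] W) :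
    C.contract (splitCasimir ℂ W W b b' t)
      = ((3 - Module.finrank ℂ W) / 2 : ℂ) • C.contract t :=
  h.map_splitCasimir_of_map_lie_top (fun x hx => inv.contract_lie ⟨x, hx⟩) t

theorem splitCasimir_mem_symSquare {t : W ⊗[ℂ] W}
    (ht : t ∈ (symSquare ℂ (derivedIdeal L) W).toSubmodule) :
    splitCasimir ℂ W W b b' t ∈ (symSquare ℂ (derivedIdeal L) W).toSubmodule := by
  have comm_t : TensorProduct.comm ℂ W W t = t := ht
  change TensorProduct.comm ℂ W W _ = _
  rw [← h.isDualPair.splitCasimir_comm h.isSymm, comm_t]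

variable {P S : LieSubmodule ℂ (derivedIdeal L) (symSquare ℂ (derivedIdeal L) W)}

theorem splitCasimir_eq_smul_of_equiv_dual (e : P ≃ₗ⁅ℂ,derivedIdeal L⁆ Module.Dual ℂ W)
    {p : symSquare ℂ (derivedIdeal L) W} (hp : p ∈ P) :
    splitCasimir ℂ W W b b' p = ((3 - Module.finrank ℂ W) / 2 : ℂ) • (p : W ⊗[ℂ] W) := by
  let ψ : Module.Dual ℂ W →ₗ[ℂ] W ⊗[ℂ] W :=
    (symSquare ℂ (derivedIdeal L) W).toSubmodule.subtype ∘ₗ P.toSubmodule.subtype ∘ₗ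
      (e.symm : Module.Dual ℂ W →ₗ[ℂ] P)
  have ψ_lie : ∀ x ∈ derivedIdeal L, ∀ f, ψ ⁅x, f⁆ = ⁅x, ψ f⁆ := fun x hx f =>
    congrArg (fun q : P => ((q : symSquare ℂ (derivedIdeal L) W) : W ⊗[ℂ] W))
      (e.symm.toLieModuleHom.map_lie ⟨x, hx⟩ f)
  have ψ_apply : ψ (e ⟨p, hp⟩) = p :=
    congrArg (fun q : P => ((q : symSquare ℂ (derivedIdeal L) W) : W ⊗[ℂ] W))
      (e.symm_apply_apply ⟨p, hp⟩)
  simpa only [ψ_apply] using h.splitCasimir_map_of_map_lie_top ψ_lie (e ⟨p, hp⟩)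

variable [Module.Finite ℂ W]

theorem exists_splitCasimir_eq_smul [LieModule.IsIrreducible ℂ (derivedIdeal L) S] :
    ∃ c : ℂ, ∀ s ∈ S, splitCasimir ℂ W W b b' s = c • (s : W ⊗[ℂ] W) := by
  let p : Submodule ℂ (W ⊗[ℂ] W) :=
    S.toSubmodule.map (symSquare ℂ (derivedIdeal L) W).toSubmodule.subtype
  have lie_mem : ∀ x ∈ derivedIdeal L, ∀ t ∈ p, ⁅x, t⁆ ∈ p := by
    rintro x hx _ ⟨s, hs, rfl⟩
    exact ⟨_, S.lie_mem (x := ⟨x, hx⟩) hs, rfl⟩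
  let T := (splitCasimir ℂ W W b b').restrict fun _ ht => h.splitCasimir_mem_symSquare ht
  have T_mem : ∀ s ∈ S.toSubmodule, T s ∈ S.toSubmodule := fun s hs => by
    obtain ⟨s', hs', h_eq⟩ := h.splitCasimir_mem_of_forall_lie_top_lie_mem lie_mem
      (Submodule.mem_map_of_mem hs)
    exact (Subtype.ext h_eq : s' = T s) ▸ hs'
  obtain ⟨c, hc⟩ := exists_forall_apply_eq_smul_of_isIrreducible
    ({ T.restrict T_mem with
        map_lie' := Subtype.ext (Subtype.ext (h.splitCasimir_lie _ _)) } :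
      S →ₗ⁅ℂ, derivedIdeal L⁆ S)
  exact ⟨c, fun s hs => congrArg Subtype.val (congrArg Subtype.val (hc ⟨s, hs⟩))⟩

theorem trace_restrict_splitCasimir_symSquare :
    LinearMap.trace ℂ _ ((splitCasimir ℂ W W b b').restrict
      fun _ ht => h.splitCasimir_mem_symSquare ht) = (Module.finrank ℂ W : ℂ) ^ 2 := by
  rw [trace_restrict_of_involutive (σ := (TensorProduct.comm ℂ W W).toLinearMap)
    (TensorProduct.comm_comm ℂ W W) (fun t => Iff.rfl) _ (h.isDualPair.splitCasimir_comm h.isSymm),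
    h.trace_splitCasimir, h.trace_splitCasimir_comp_comm]
  ring

theorem splitCasimir_eq_three_smul (hPS : IsCompl P S)
    (e : P ≃ₗ⁅ℂ,derivedIdeal L⁆ Module.Dual ℂ W)
    (hS : S = ⊥ ∨ LieModule.IsIrreducible ℂ (derivedIdeal L) S)
    {s : symSquare ℂ (derivedIdeal L) W} (hs : s ∈ S) :
    splitCasimir ℂ W W b b' s = (3 : ℂ) • (s : W ⊗[ℂ] W) := by
  rcases hS with rfl | hS
  · rw [(LieSubmodule.mem_bot s).mp hs]
    simp
  obtain ⟨c, hc⟩ := h.exists_splitCasimir_eq_smul (S := S)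
  have hPS' := LieSubmodule.isCompl_toSubmodule.mpr hPS
  have finrank_P : Module.finrank ℂ P = Module.finrank ℂ W :=
    e.toLinearEquiv.finrank_eq.trans Subspace.dual_finrank_eq
  have finrank_add : (Module.finrank ℂ W + Module.finrank ℂ S : ℂ)
      = Module.finrank ℂ (symSquare ℂ (derivedIdeal L) W) := by
    rw [← finrank_P]
    exact_mod_cast Submodule.finrank_add_eq_of_isCompl hPS'
  have trace_eq : (Module.finrank ℂ W : ℂ) ^ 2
      = (3 - Module.finrank ℂ W) / 2 * Module.finrank ℂ P + c * Module.finrank ℂ S :=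
    h.trace_restrict_splitCasimir_symSquare.symm.trans (trace_eq_of_isCompl hPS'
      (fun p hp => Subtype.ext (h.splitCasimir_eq_smul_of_equiv_dual e hp))
      fun s hs => Subtype.ext (hc s hs))
  have c_eq : (c - 3) * Module.finrank ℂ S = 0 := by
    rw [finrank_P] at trace_eq
    linear_combination -3 * finrank_add
      - 3 / 2 * two_mul_finrank_symSquare (W := W) (derivedIdeal L) - trace_eq
  have : Nontrivial S := LieModule.nontrivial_of_isIrreducible ℂ (derivedIdeal L) S
  have finrank_ne : (Module.finrank ℂ S : ℂ) ≠ 0 := Nat.cast_ne_zero.mpr Module.finrank_pos.ne'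
  rw [hc s hs, sub_eq_zero.mp ((mul_eq_zero.mp c_eq).resolve_right finrank_ne)]

theorem contract_eq_zero_of_mem (hPS : IsCompl P S)
    (e : P ≃ₗ⁅ℂ,derivedIdeal L⁆ Module.Dual ℂ W)
    (hS : S = ⊥ ∨ LieModule.IsIrreducible ℂ (derivedIdeal L) S)
    (inv : C.IsInvariant (derivedIdeal L)) {s : symSquare ℂ (derivedIdeal L) W} (hs : s ∈ S) :
    C.contract s = 0 := by
  have smul_eq_smul := h.contract_splitCasimir inv s
  rw [h.splitCasimir_eq_three_smul hPS e hS hs, map_smul, ← sub_eq_zero, ← sub_smul] at smul_eq_smul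
  refine (smul_eq_zero.mp smul_eq_smul).resolve_left fun three_eq => ?_
  have : ((Module.finrank ℂ W + 3 : ℕ) : ℂ) = 0 := by
    push_cast
    linear_combination 2 * three_eq
  exact absurd this (Nat.cast_ne_zero.mpr (by lia))

variable [LieModule.IsIrreducible ℂ L W]

theorem mem_of_contract_eq_zero (hPS : IsCompl P S)
    (e : P ≃ₗ⁅ℂ,derivedIdeal L⁆ Module.Dual ℂ W)
    (hS : S = ⊥ ∨ LieModule.IsIrreducible ℂ (derivedIdeal L) S)
    (hC : C.toFun ≠ 0) (inv : C.IsInvariant (derivedIdeal L))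
    {t : symSquare ℂ (derivedIdeal L) W} (ht : C.contract t = 0) : t ∈ S := by
  let g : P →ₗ[ℂ] Module.Dual ℂ W := C.contract ∘ₗ
    (symSquare ℂ (derivedIdeal L) W).toSubmodule.subtype ∘ₗ P.toSubmodule.subtype
  have exists_add (q : symSquare ℂ (derivedIdeal L) W) :
      ∃ p : P, ∃ s ∈ S, (p : symSquare ℂ (derivedIdeal L) W) + s = q := by
    obtain ⟨p, hp, s, hs, rfl⟩ := (LieSubmodule.mem_sup _ _ q).mp
      (hPS.sup_eq_top ▸ LieSubmodule.mem_top q)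
    exact ⟨⟨p, hp⟩, s, hs, rfl⟩
  have g_eq {p : P} {s q} (hs : s ∈ S) (hps : (p : symSquare ℂ (derivedIdeal L) W) + s = q) :
      g p = C.contract q := by
    rw [← hps]
    change _ = C.contract (_ + _)
    rw [map_add, h.contract_eq_zero_of_mem hPS e hS inv hs, add_zero]
    rfl
  have g_surjective : Function.Surjective g := fun f => by
    obtain ⟨t, rfl⟩ := C.contract_surjective (h.ker_toFun_eq_bot hC inv) f
    let q : symSquare ℂ (derivedIdeal L) W := ⟨(1 / 2 : ℂ) • (t + TensorProduct.comm ℂ W W t), by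
      change TensorProduct.comm ℂ W W _ = _
      rw [map_smul, map_add, TensorProduct.comm_comm, add_comm]⟩
    obtain ⟨p, s, hs, hps⟩ := exists_add q
    refine ⟨p, (g_eq hs hps).trans ?_⟩
    change C.contract ((1 / 2 : ℂ) • (t + TensorProduct.comm ℂ W W t)) = _
    rw [map_smul, map_add, C.contract_comm]
    module
  have g_injective : Function.Injective g :=
    (LinearMap.injective_iff_surjective_of_finrank_eq_finrank
      e.toLinearEquiv.finrank_eq).mpr g_surjective
  obtain ⟨p, s, hs, hps⟩ := exists_add t
  have hp : p = 0 := g_injective ((g_eq hs hps).trans (ht.trans (map_zero g).symm))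
  rw [← hps, hp]
  simpa using hs

theorem splitCasimir_eq_of_contract_eq_zero (hPS : IsCompl P S)
    (e : P ≃ₗ⁅ℂ,derivedIdeal L⁆ Module.Dual ℂ W)
    (hS : S = ⊥ ∨ LieModule.IsIrreducible ℂ (derivedIdeal L) S)
    (halt : altSquare ℂ L W = ⊥ ∨ LieModule.IsIrreducible ℂ L (altSquare ℂ L W))
    (hC : C.toFun ≠ 0) (inv : C.IsInvariant (derivedIdeal L))
    {t : W ⊗[ℂ] W} (ht : C.contract t = 0) :
    splitCasimir ℂ W W b b' t = (3 / 2 : ℂ) • (t + TensorProduct.comm ℂ W W t) := by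
  have mem_alt : t - TensorProduct.comm ℂ W W t ∈ altSquare ℂ L W := by
    change TensorProduct.comm ℂ W W _ = _
    rw [map_sub, TensorProduct.comm_comm, neg_sub]
  let q : symSquare ℂ (derivedIdeal L) W := ⟨t + TensorProduct.comm ℂ W W t, by
    change TensorProduct.comm ℂ W W _ = _
    rw [map_add, TensorProduct.comm_comm, add_comm]⟩
  have hq : q ∈ S := h.mem_of_contract_eq_zero hPS e hS hC inv (by
    change C.contract (_ + _) = 0
    rw [map_add, C.contract_comm, ht, add_zero])
  have t_eq : t = (1 / 2 : ℂ) • ((t + TensorProduct.comm ℂ W W t)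
      + (t - TensorProduct.comm ℂ W W t)) := by module
  conv_lhs => rw [t_eq, map_smul, map_add, h.splitCasimir_eq_zero_of_mem_altSquare halt mem_alt,
    add_zero]
  rw [h.splitCasimir_eq_three_smul hPS e hS hq]
  module

end IsNormalizedForm

end SymmetricPart

section Pairing

section CommRing

variable {R L M ι : Type*} [CommRing R] [LieRing L] [LieAlgebra R L] [AddCommGroup M] [Module R M]
  [LieRingModule L M] [LieModule R L M] [Fintype ι]

variable (R M) in
/-- For families `b`, `b'` dual with respect to a bilinear form `K`, the map `θ : M × M* → L` which
is dual to the action of `L` on `M`, that is, `K x (θ u f) = f ⁅x, u⁆`. -/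
def dualPairing (b b' : ι → L) : M →ₗ[R] Module.Dual R M →ₗ[R] L :=
  LinearMap.mk₂ R (fun u f => ∑ i, f ⁅b i, u⁆ • b' i)
    (fun _ _ _ => by simp [add_smul, Finset.sum_add_distrib])
    (fun _ _ _ => by simp [mul_smul, Finset.smul_sum])
    (fun _ _ _ => by simp [add_smul, Finset.sum_add_distrib])
    (fun _ _ _ => by simp [mul_smul, Finset.smul_sum])

variable {K : LinearMap.BilinForm R L} {b b' : ι → L}

theorem dualPairing_apply (u : M) (f : Module.Dual R M) :
    dualPairing R M b b' u f = ∑ i, f ⁅b i, u⁆ • b' i := rfl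

theorem dualDistrib_splitCasimir_tmul (u v : M) (f g : Module.Dual R M) :
    TensorProduct.dualDistrib R M M (f ⊗ₜ g) (splitCasimir R M M b b' (u ⊗ₜ v))
      = g ⁅dualPairing R M b b' u f, v⁆ := by
  simp [splitCasimir_tmul, dualPairing_apply, sum_lie]

theorem IsDualPair.apply_dualPairing (h : IsDualPair K b b') (x : L) (u : M)
    (f : Module.Dual R M) : K x (dualPairing R M b b' u f) = f ⁅x, u⁆ := by
  conv_rhs => rw [← h.sum_right x, _root_.sum_lie]
  simp [dualPairing_apply, mul_comm]

end CommRing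

variable {L W ι : Type*} [LieRing L] [LieAlgebra ℂ L] [AddCommGroup W] [Module ℂ W]
  [LieRingModule L W] [LieModule ℂ L W] {θ : W →ₗ[ℂ] Module.Dual ℂ W →ₗ[ℂ] L}
  {K : LinearMap.BilinForm ℂ L}

omit [LieModule ℂ L W] in
theorem apply_lie_eq_apply_lie_of_isSymm (symm : K.IsSymm)
    (adjoint : ∀ (x : L) (u : W) (f : Module.Dual ℂ W), K x (θ u f) = f ⁅x, u⁆) (u v : W)
    (f g : Module.Dual ℂ W) : g ⁅θ u f, v⁆ = f ⁅θ v g, u⁆ := by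
  rw [← adjoint, ← adjoint, symm.eq]

theorem isLiePairing_of_lie_comm (symm : K.IsSymm) (nondeg : K.Nondegenerate)
    (inv : K.lieInvariant L)
    (adjoint : ∀ (x : L) (u : W) (f : Module.Dual ℂ W), K x (θ u f) = f ⁅x, u⁆)
    (lie_comm : ∀ (u v : W) (f : Module.Dual ℂ W), ⁅θ u f, v⁆ = ⁅θ v f, u⁆) :
    IsLiePairing θ where
  equivariant x u f := by
    rw [← sub_eq_zero]
    refine nondeg.2 _ fun y => ?_
    have invariance : K y ⁅x, θ u f⁆ = -K ⁅x, y⁆ (θ u f) := by rw [inv, neg_neg]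
    rw [map_sub, map_add, invariance, adjoint, adjoint, adjoint, Module.Dual.lie_apply, lie_lie,
      map_sub]
    ring
  symm_left := lie_comm
  symm_right u f g := by
    ext v
    rw [Module.Dual.lie_apply, Module.Dual.lie_apply, apply_lie_eq_apply_lie_of_isSymm symm adjoint,
      lie_comm]

variable [Fintype ι] {b b' : ι → L} {z : L}

theorem IsNormalizedForm.isLiePairing [Module.Finite ℂ W] (h : IsNormalizedForm W K z b b')
    (halt : altSquare ℂ L W = ⊥ ∨ LieModule.IsIrreducible ℂ L (altSquare ℂ L W)) :
    IsLiePairing (dualPairing ℂ W b b') := by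
  refine isLiePairing_of_lie_comm h.isSymm h.nondegenerate h.lieInvariant
    h.isDualPair.apply_dualPairing fun u v f => ?_
  have splitCasimir_eq : splitCasimir ℂ W W b b' (u ⊗ₜ v) = splitCasimir ℂ W W b b' (v ⊗ₜ u) := by
    rw [← sub_eq_zero, ← map_sub]
    refine h.splitCasimir_eq_zero_of_mem_altSquare halt ?_
    change TensorProduct.comm ℂ W W _ = -_
    simp
  refine sub_eq_zero.mp ((Module.forall_dual_apply_eq_zero_iff ℂ _).mp fun g => ?_)
  rw [map_sub, sub_eq_zero, ← dualDistrib_splitCasimir_tmul, ← dualDistrib_splitCasimir_tmul,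
    splitCasimir_eq]

end Pairing

namespace CubicForm

variable {W : Type*} [AddCommGroup W] [Module ℂ W] {C : CubicForm W}

theorem dual_hom_ext [Module.Finite ℂ W] (hC : LinearMap.ker C.toFun = ⊥) {N : Type*}
    [AddCommGroup N] [Module ℂ N] {φ ψ : Module.Dual ℂ W →ₗ[ℂ] N}
    (h : ∀ u v, φ (C.toFun u v) = ψ (C.toFun u v)) : φ = ψ :=
  (LinearMap.cancel_right (C.contract_surjective hC)).mp (TensorProduct.ext' h)

end CubicForm

section DualCubic

variable {L W ι : Type*} [LieRing L] [LieAlgebra ℂ L] [AddCommGroup W] [Module ℂ W]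
  [LieRingModule L W] [LieModule ℂ L W] {C : CubicForm W}

theorem IsNormalizedForm.toFun_lie [Fintype ι] {M : Type*} [AddCommGroup M] [Module ℂ M]
    [LieRingModule L M] [LieModule ℂ L M] {K : LinearMap.BilinForm ℂ L} {z : L} {b b' : ι → L}
    (h : IsNormalizedForm W K z b b') {C : CubicForm M} (inv : C.IsInvariant (derivedIdeal L))
    {c : ℂ} (hz : ∀ m : M, ⁅z, m⁆ = c • m) (x : L) (u v w : M) :
    C.toFun ⁅x, u⁆ v w + C.toFun u ⁅x, v⁆ w + C.toFun u v ⁅x, w⁆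
      = 3 * (c * K z x) * C.toFun u v w := by
  have lie_eq (m : M) : ⁅x, m⁆ = ⁅x - K z x • z, m⁆ + (c * K z x) • m := by
    rw [sub_lie, smul_lie, hz]
    module
  have inv_x := inv ⟨_, h.sub_smul_mem_lie_top x⟩ u v w
  change C.toFun ⁅x - K z x • z, u⁆ v w + C.toFun u ⁅x - K z x • z, v⁆ w
    + C.toFun u v ⁅x - K z x • z, w⁆ = 0 at inv_x
  rw [lie_eq u, lie_eq v, lie_eq w]
  simp only [map_add, map_smul, LinearMap.add_apply, LinearMap.smul_apply, smul_eq_mul]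
  linear_combination inv_x

/-- A trilinear form `D` on `W*` is dual to the cubic form `C` on `W`, with respect to the pairing
`θ`, if contracting `C` against it expresses the action of `θ`; this is the relation that makes
the commutator of `W` and `W*` act on `V` through `θ`. -/
def IsDualTrilinear (θ : W →ₗ[ℂ] Module.Dual ℂ W →ₗ[ℂ] L) (C : CubicForm W)
    (D : Module.Dual ℂ W →ₗ[ℂ] Module.Dual ℂ W →ₗ[ℂ] Module.Dual ℂ W →ₗ[ℂ] ℂ) : Prop :=
  ∀ t r f g, D (C.toFun t r) f g = 3 / 2 * (f t * g r + f r * g t) - g ⁅θ t f, r⁆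

theorem exists_isDualTrilinear [Fintype ι] [Module.Finite ℂ W] {b b' : ι → L}
    (hC : LinearMap.ker C.toFun = ⊥)
    (hT : ∀ t, C.contract t = 0 →
      splitCasimir ℂ W W b b' t = (3 / 2 : ℂ) • (t + TensorProduct.comm ℂ W W t)) :
    ∃ D, IsDualTrilinear (dualPairing ℂ W b b') C D := by
  let Q : W ⊗[ℂ] W →ₗ[ℂ] W ⊗[ℂ] W :=
    (3 / 2 : ℂ) • (LinearMap.id + (TensorProduct.comm ℂ W W).toLinearMap)
      - splitCasimir ℂ W W b b'
  have Q_eq_zero {t} (ht : C.contract t = 0) : Q t = 0 := sub_eq_zero.mpr (hT t ht).symm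
  obtain ⟨s, hs⟩ := C.contract.exists_rightInverse_of_surjective
    (LinearMap.range_eq_top.mpr (C.contract_surjective hC))
  have Q_s_contract (t) : Q (s (C.contract t)) = Q t := by
    rw [← sub_eq_zero, ← map_sub]
    refine Q_eq_zero ?_
    rw [map_sub, sub_eq_zero]
    exact LinearMap.congr_fun hs _
  refine ⟨(LinearMap.lflip.toLinearMap ∘ₗ
    TensorProduct.curry (TensorProduct.dualDistrib ℂ W W)).flip ∘ₗ Q ∘ₗ s, fun t r f g => ?_⟩
  change TensorProduct.dualDistrib ℂ W W (f ⊗ₜ g) (Q (s (C.contract (t ⊗ₜ r)))) = _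
  rw [Q_s_contract, ← dualDistrib_splitCasimir_tmul]
  simp [Q, mul_add]

namespace IsDualTrilinear

variable {θ : W →ₗ[ℂ] Module.Dual ℂ W →ₗ[ℂ] L}
  {D : Module.Dual ℂ W →ₗ[ℂ] Module.Dual ℂ W →ₗ[ℂ] Module.Dual ℂ W →ₗ[ℂ] ℂ}
  (h : IsDualTrilinear θ C D) (hθ : IsLiePairing θ)
include h

omit [LieModule ℂ L W] in
theorem apply_toFun_toFun {K : LinearMap.BilinForm ℂ L} (symm : K.IsSymm)
    (adjoint : ∀ (x : L) (u : W) (f : Module.Dual ℂ W), K x (θ u f) = f ⁅x, u⁆)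
    (t r s w : W) (g : Module.Dual ℂ W) :
    D (C.toFun t r) (C.toFun s w) g
      = 3 / 2 * (C.toFun s w t * g r + C.toFun s w r * g t) - C.toFun s w ⁅θ r g, t⁆ := by
  rw [h, apply_lie_eq_apply_lie_of_isSymm symm adjoint]

variable [Module.Finite ℂ W] (hC : LinearMap.ker C.toFun = ⊥)

include hθ hC

theorem symm_right (f g h' : Module.Dual ℂ W) : D f g h' = D f h' g := by
  have D_eq : D = LinearMap.lflip.toLinearMap ∘ₗ D :=
    CubicForm.dual_hom_ext hC fun t r => LinearMap.ext₂ fun g h' => by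
      have lie_eq := LinearMap.congr_fun (hθ.symm_right t g h') r
      rw [Module.Dual.lie_apply, Module.Dual.lie_apply] at lie_eq
      change _ = D (C.toFun t r) h' g
      rw [h, h]
      linear_combination lie_eq
  exact LinearMap.congr_fun₂ (LinearMap.congr_fun D_eq f) g h'

theorem symm_left {K : LinearMap.BilinForm ℂ L} (symm : K.IsSymm)
    (adjoint : ∀ (x : L) (u : W) (f : Module.Dual ℂ W), K x (θ u f) = f ⁅x, u⁆) {z : L}
    (hz : ∀ w : W, ⁅z, w⁆ = w)
    (quasi_inv : ∀ (x : L) (u v w : W), C.toFun ⁅x, u⁆ v w + C.toFun u ⁅x, v⁆ w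
      + C.toFun u v ⁅x, w⁆ = 3 * K z x * C.toFun u v w)
    (f g h' : Module.Dual ℂ W) : D f g h' = D g f h' := by
  have D_flip : D = D.flip := CubicForm.dual_hom_ext hC fun t r =>
    CubicForm.dual_hom_ext hC fun s w => LinearMap.ext fun g => by
      rw [LinearMap.flip_apply, h.apply_toFun_toFun symm adjoint,
        h.apply_toFun_toFun symm adjoint]
      have apply_z (u : W) : K z (θ u g) = g u := by rw [adjoint, hz]
      have inv_last (u a b c : W) : C.toFun b c ⁅θ u g, a⁆ + C.toFun a c ⁅θ u g, b⁆
          + C.toFun a b ⁅θ u g, c⁆ = 3 * g u * C.toFun a b c := by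
        rw [← apply_z, ← quasi_inv, C.symm_right b, C.symm_left b, C.symm_right a c, C.symm_right]
      have symm_t : C.toFun s w t = C.toFun t s w := by rw [C.symm_right, C.symm_left]
      have symm_r : C.toFun s w r = C.toFun r s w := by rw [C.symm_right, C.symm_left]
      have lie_comm (u v : W) : ⁅θ u g, v⁆ = ⁅θ v g, u⁆ := hθ.symm_left u v g
      have inv_t := inv_last t r s w
      have inv_r := inv_last r t s w
      have inv_s := inv_last s t r w
      have inv_w := inv_last w t r s
      rw [lie_comm r t, lie_comm r s, lie_comm r w] at inv_r
      rw [lie_comm s t, lie_comm s w] at inv_s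
      rw [lie_comm w t] at inv_w
      rw [lie_comm r t, symm_t, symm_r]
      -- Each of the six brackets `⁅θ u g, v⁆ = ⁅θ v g, u⁆` occurs in two of the four identities;
      -- the signs are such that only `⁅θ t g, r⁆` and `⁅θ s g, w⁆` survive.
      linear_combination (1 / 2 : ℂ) * (inv_s + inv_w - inv_t - inv_r)
  exact LinearMap.congr_fun₂ (LinearMap.congr_fun D_flip f) g h'

omit hC [Module.Finite ℂ W] in
theorem apply_lie_toFun {x : L}
    (inv : ∀ u v w, C.toFun ⁅x, u⁆ v w + C.toFun u ⁅x, v⁆ w + C.toFun u v ⁅x, w⁆ = 0)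
    (t r : W) (f g : Module.Dual ℂ W) :
    D ⁅x, C.toFun t r⁆ f g + D (C.toFun t r) ⁅x, f⁆ g + D (C.toFun t r) f ⁅x, g⁆ = 0 := by
  have lie_toFun : ⁅x, C.toFun t r⁆ = C.toFun ⁅x, t⁆ r + C.toFun t ⁅x, r⁆ := by
    ext w
    rw [Module.Dual.lie_apply, LinearMap.add_apply]
    linear_combination -inv t r w
  have lie_θ : g ⁅θ ⁅x, t⁆ f, r⁆ + g ⁅θ t ⁅x, f⁆, r⁆
      = g ⁅x, ⁅θ t f, r⁆⁆ - g ⁅θ t f, ⁅x, r⁆⁆ := by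
    rw [← map_add, ← add_lie, ← hθ.equivariant, lie_lie, map_sub]
  rw [lie_toFun, map_add, LinearMap.add_apply, LinearMap.add_apply, h, h, h, h]
  simp only [Module.Dual.lie_apply]
  linear_combination -lie_θ

theorem lie_apply_eq_zero {x : L}
    (inv : ∀ u v w, C.toFun ⁅x, u⁆ v w + C.toFun u ⁅x, v⁆ w + C.toFun u v ⁅x, w⁆ = 0)
    (e f g : Module.Dual ℂ W) : D ⁅x, e⁆ f g + D e ⁅x, f⁆ g + D e f ⁅x, g⁆ = 0 := by
  let φ : Module.Dual ℂ W →ₗ[ℂ] ℂ :=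
    (D.flip f).flip g ∘ₗ LieModule.toEnd ℂ L (Module.Dual ℂ W) x
      + (D.flip ⁅x, f⁆).flip g + (D.flip f).flip ⁅x, g⁆
  have φ_eq : φ = 0 := CubicForm.dual_hom_ext hC fun t r => h.apply_lie_toFun hθ inv t r f g
  exact LinearMap.congr_fun φ_eq e

omit hC hθ in
theorem ne_zero [Nontrivial W] (trace_θ : ∀ t f, LinearMap.trace ℂ W
    (LieModule.toEnd ℂ L W (θ t f)) = Module.finrank ℂ W * f t) : D ≠ 0 := by
  rintro rfl
  obtain ⟨t, ht⟩ := exists_ne (0 : W)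
  obtain ⟨f, hf⟩ := Module.Projective.exists_dual_eq_one ℂ ht
  have toEnd_θ : LieModule.toEnd ℂ L W (θ t f)
      = (3 / 2 : ℂ) • (LinearMap.id + f.smulRight t) := LinearMap.ext fun r => by
    refine sub_eq_zero.mp ((Module.forall_dual_apply_eq_zero_iff ℂ _).mp fun g => ?_)
    have h_apply : 0 = 3 / 2 * (f t * g r + f r * g t) - g ⁅θ t f, r⁆ := h t r f g
    rw [hf] at h_apply
    simp only [map_sub, LinearMap.smul_apply, LinearMap.add_apply, LinearMap.id_apply,
      LinearMap.smulRight_apply, LieModule.toEnd_apply_apply, map_smul, map_add, smul_eq_mul]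
    linear_combination h_apply
  have finrank_eq : ((Module.finrank ℂ W + 3 : ℕ) : ℂ) = 0 := by
    have trace_eq := trace_θ t f
    rw [toEnd_θ, map_smul, map_add, LinearMap.trace_id, LinearMap.trace_smulRight, hf,
      smul_eq_mul] at trace_eq
    push_cast
    linear_combination 2 * trace_eq
  exact absurd finrank_eq (Nat.cast_ne_zero.mpr (by lia))

end IsDualTrilinear

theorem IsNormalizedForm.exists_isDualTrilinear [Fintype ι] [Module.Finite ℂ W]
    [LieModule.IsIrreducible ℂ L W] {K : LinearMap.BilinForm ℂ L} {z : L} {b b' : ι → L}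
    (h : IsNormalizedForm W K z b b') (hθ : IsLiePairing (dualPairing ℂ W b b'))
    (hC : C.toFun ≠ 0) (inv : C.IsInvariant (derivedIdeal L))
    (hT : ∀ t, C.contract t = 0 →
      splitCasimir ℂ W W b b' t = (3 / 2 : ℂ) • (t + TensorProduct.comm ℂ W W t)) :
    ∃ C' : CubicForm (Module.Dual ℂ W), C'.toFun ≠ 0 ∧ C'.IsInvariant (derivedIdeal L) ∧
      IsDualTrilinear (dualPairing ℂ W b b') C C'.toFun := by
  have : Nontrivial W := LieModule.nontrivial_of_isIrreducible ℂ L W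
  have ker_eq := h.ker_toFun_eq_bot hC inv
  have adjoint := h.isDualPair.apply_dualPairing (M := W)
  obtain ⟨D, hD⟩ := _root_.exists_isDualTrilinear ker_eq hT
  refine ⟨⟨D, hD.symm_left hθ ker_eq h.isSymm adjoint h.lie_eq_self fun x => ?_,
    hD.symm_right hθ ker_eq⟩, hD.ne_zero fun t f => ?_,
    fun x => hD.lie_apply_eq_zero hθ ker_eq (inv x), hD⟩
  · simpa only [one_mul] using
      h.toFun_lie inv (c := 1) (fun w => by rw [h.lie_eq_self, one_smul]) x
  · rw [h.trace_toEnd, adjoint, h.lie_eq_self]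

end DualCubic

section Eigenvector

variable {k L M : Type*} [Field k] [IsAlgClosed k] [LieRing L] [LieAlgebra k L] [AddCommGroup M]
  [Module k M] [Module.Finite k M] [LieRingModule L M] [LieModule k L M]

theorem exists_mem_ne_zero_lie_eq_smul {N : LieSubmodule k L M} (hN : N ≠ ⊥) (x : L) :
    ∃ c : k, ∃ v ∈ N, v ≠ 0 ∧ ⁅x, v⁆ = c • v := by
  have : Nontrivial N := (LieSubmodule.nontrivial_iff_ne_bot k L M).mpr hN
  obtain ⟨c, hc⟩ := Module.End.exists_eigenvalue (LieModule.toEnd k L N x)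
  obtain ⟨v, hv⟩ := hc.exists_hasEigenvector
  exact ⟨c, v, v.2, fun v_eq => hv.2 (Subtype.ext v_eq), congrArg Subtype.val hv.apply_eq_smul⟩

end Eigenvector

section CubicModule

variable {L W : Type*} [LieRing L] [LieAlgebra ℂ L] [AddCommGroup W] [Module ℂ W]
  [LieRingModule L W] [LieModule ℂ L W]

variable (W) in
/-- The underlying space `V = ℂ ⊕ W ⊕ W* ⊕ ℂ` of the module attached to a pair of cubic forms on
`W` and `W*`. -/
abbrev CubicModule : Type _ := ℂ × W × Module.Dual ℂ W × ℂ

theorem CubicModule.ext_of_dual {p q : CubicModule W} (h₀ : p.1 = q.1)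
    (h₁ : ∀ g : Module.Dual ℂ W, g p.2.1 = g q.2.1) (h₂ : ∀ w, p.2.2.1 w = q.2.2.1 w)
    (h₃ : p.2.2.2 = q.2.2.2) : p = q := by
  refine Prod.ext h₀ (Prod.ext ?_ (Prod.ext (LinearMap.ext h₂) h₃))
  exact Module.eval_apply_injective ℂ (LinearMap.ext h₁)

/-- The compatibilities between `θ`, a linear form `ζ` on `L` and cubic forms `C`, `C'` on `W`, `W*`
under which `L ⊕ W ⊕ W*` acts on `ℂ ⊕ W ⊕ W* ⊕ ℂ`. The form `ζ` gives the action of `L` on the two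
lines. -/
structure IsCubicPair (θ : W →ₗ[ℂ] Module.Dual ℂ W →ₗ[ℂ] L) (ζ : L →ₗ[ℂ] ℂ)
    (C : CubicForm W) (C' : CubicForm (Module.Dual ℂ W)) : Prop where
  map_lie : ∀ x y : L, ζ ⁅x, y⁆ = 0
  map_pairing : ∀ u f, ζ (θ u f) = f u
  lie_left : ∀ (x : L) u v w, C.toFun ⁅x, u⁆ v w + C.toFun u ⁅x, v⁆ w + C.toFun u v ⁅x, w⁆
    = 3 * ζ x * C.toFun u v w
  lie_right : ∀ (x : L) f g h, C'.toFun ⁅x, f⁆ g h + C'.toFun f ⁅x, g⁆ h + C'.toFun f g ⁅x, h⁆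
    = -(3 * ζ x) * C'.toFun f g h
  isDualTrilinear : IsDualTrilinear θ C C'.toFun

variable [Module.Finite ℂ W] {θ : W →ₗ[ℂ] Module.Dual ℂ W →ₗ[ℂ] L} {hθ : IsLiePairing θ}
  {ζ : L →ₗ[ℂ] ℂ} {C : CubicForm W} {C' : CubicForm (Module.Dual ℂ W)}

namespace CubicForm

variable (C') in
/-- The contraction `C'(f s) ∈ W` of a cubic form on `W*` with two elements of `W*`. -/
def contractDual : Module.Dual ℂ W →ₗ[ℂ] Module.Dual ℂ W →ₗ[ℂ] W :=
  C'.toFun.compr₂ (Module.evalEquiv ℂ W).symm.toLinearMap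

theorem apply_contractDual (f s g : Module.Dual ℂ W) :
    g (C'.contractDual f s) = C'.toFun f s g :=
  Module.apply_evalEquiv_symm_apply ℂ W g (C'.toFun f s)

theorem apply_lie_contractDual (x : L) (f s g : Module.Dual ℂ W) :
    g ⁅x, C'.contractDual f s⁆ = -C'.toFun f s ⁅x, g⁆ := by
  rw [← apply_contractDual, Module.Dual.lie_apply, neg_neg]

theorem toFun_contractDual (t w : W) (f s : Module.Dual ℂ W) :
    C.toFun t (C'.contractDual f s) w = C'.toFun (C.toFun t w) f s := by
  rw [C.symm_right, apply_contractDual, C'.symm_right, C'.symm_left]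

end CubicForm

/-- The action of `L ⊕ W ⊕ W*` on `ℂ ⊕ W ⊕ W* ⊕ ℂ` attached to a linear form `ζ` on `L` and cubic
forms on `W` and `W*`. -/
def cubicAction (ζ : L →ₗ[ℂ] ℂ) (C : CubicForm W) (C' : CubicForm (Module.Dual ℂ W)) :
    L × W × Module.Dual ℂ W →ₗ[ℂ] CubicModule W →ₗ[ℂ] CubicModule W :=
  LinearMap.mk₂ ℂ (fun a v =>
    (-(3 / 2) * ζ a.1 * v.1 + 1 / 2 * a.2.2 v.2.1,
      ⁅a.1, v.2.1⁆ - (3 / 2 * ζ a.1) • v.2.1 + (3 * v.1) • a.2.1 + C'.contractDual a.2.2 v.2.2.1,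
      ⁅a.1, v.2.2.1⁆ + (3 / 2 * ζ a.1) • v.2.2.1 + C.toFun a.2.1 v.2.1 + (3 * v.2.2.2) • a.2.2,
      3 / 2 * ζ a.1 * v.2.2.2 + 1 / 2 * v.2.2.1 a.2.1))
    (fun a b v => by
      simp only [Prod.fst_add, Prod.snd_add, map_add, add_lie, LinearMap.add_apply, Prod.mk_add_mk,
        Prod.mk.injEq]
      exact ⟨by ring, by module, by module, by ring⟩)
    (fun c a v => by
      simp only [Prod.smul_fst, Prod.smul_snd, map_smul, smul_lie, LinearMap.smul_apply,
        Prod.smul_mk, Prod.mk.injEq, smul_eq_mul]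
      exact ⟨by ring, by module, by module, by ring⟩)
    (fun a v w => by
      simp only [Prod.fst_add, Prod.snd_add, map_add, lie_add, LinearMap.add_apply, Prod.mk_add_mk,
        Prod.mk.injEq]
      exact ⟨by ring, by module, by module, by ring⟩)
    (fun c a v => by
      simp only [Prod.smul_fst, Prod.smul_snd, map_smul, lie_smul, LinearMap.smul_apply,
        Prod.smul_mk, Prod.mk.injEq, smul_eq_mul]
      exact ⟨by ring, by module, by module, by ring⟩)

theorem cubicAction_apply (a : L × W × Module.Dual ℂ W) (v : CubicModule W) :
    cubicAction ζ C C' a v =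
      (-(3 / 2) * ζ a.1 * v.1 + 1 / 2 * a.2.2 v.2.1,
        ⁅a.1, v.2.1⁆ - (3 / 2 * ζ a.1) • v.2.1 + (3 * v.1) • a.2.1 + C'.contractDual a.2.2 v.2.2.1,
        ⁅a.1, v.2.2.1⁆ + (3 / 2 * ζ a.1) • v.2.2.1 + C.toFun a.2.1 v.2.1 + (3 * v.2.2.2) • a.2.2,
        3 / 2 * ζ a.1 * v.2.2.2 + 1 / 2 * v.2.2.1 a.2.1) := rfl

theorem cubicAction_mk_zero_zero (x : L) (v : CubicModule W) :
    cubicAction ζ C C' (x, 0, 0) v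
      = (-(3 / 2) * ζ x * v.1, ⁅x, v.2.1⁆ - (3 / 2 * ζ x) • v.2.1,
        ⁅x, v.2.2.1⁆ + (3 / 2 * ζ x) • v.2.2.1, 3 / 2 * ζ x * v.2.2.2) := by
  simp [cubicAction_apply]

theorem cubicAction_raise (t : W) (v : CubicModule W) :
    cubicAction ζ C C' ((0 : L), t, 0) v
      = (0, (3 * v.1) • t, C.toFun t v.2.1, 1 / 2 * v.2.2.1 t) := by
  simp [cubicAction_apply]

theorem cubicAction_lower (f : Module.Dual ℂ W) (v : CubicModule W) :
    cubicAction ζ C C' ((0 : L), 0, f) v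
      = (1 / 2 * f v.2.1, C'.contractDual f v.2.2.1, (3 * v.2.2.2) • f, 0) := by
  simp [cubicAction_apply]

omit [Module.Finite ℂ W] in
theorem IsNormalizedForm.isCubicPair {ι : Type*} [Fintype ι] {K : LinearMap.BilinForm ℂ L} {z : L}
    {b b' : ι → L} (h : IsNormalizedForm W K z b b') (inv : C.IsInvariant (derivedIdeal L))
    (inv' : C'.IsInvariant (derivedIdeal L))
    (dual : IsDualTrilinear (dualPairing ℂ W b b') C C'.toFun) :
    IsCubicPair (dualPairing ℂ W b b') (K z) C C' where
  map_lie := h.apply_lie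
  map_pairing u f := by rw [h.isDualPair.apply_dualPairing, h.lie_eq_self]
  lie_left x u v w := by
    rw [h.toFun_lie inv (c := 1) (fun w => by rw [h.lie_eq_self, one_smul]), one_mul]
  lie_right x f g k := by
    rw [h.toFun_lie inv' (c := -1) fun f => by
      rw [dual_lie_eq_neg_of_lie_eq_self h.lie_eq_self, neg_one_smul]]
    ring
  isDualTrilinear := dual

namespace IsCubicPair

variable (h : IsCubicPair θ ζ C C')
include h

omit [Module.Finite ℂ W] in
theorem apply_eq_zero_of_mem_derivedIdeal {x : L} (hx : x ∈ derivedIdeal L) : ζ x = 0 := by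
  have mem_span : x ∈ (derivedIdeal L).toSubmodule := hx
  rw [LieSubmodule.lieIdeal_oper_eq_linear_span'] at mem_span
  refine Submodule.span_le (p := LinearMap.ker ζ) |>.mpr ?_ mem_span
  rintro _ ⟨y, -, y', -, rfl⟩
  exact h.map_lie y y'

variable (hθ) in
theorem cubicAction_leibniz (a b : GradedLie θ hθ) (v : CubicModule W) :
    cubicAction ζ C C' a (cubicAction ζ C C' b v)
      = cubicAction ζ C C' (⁅a, b⁆ : GradedLie θ hθ) v
        + cubicAction ζ C C' b (cubicAction ζ C C' a v) := by
  obtain ⟨x, t, f⟩ := a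
  obtain ⟨y, u, k⟩ := b
  obtain ⟨α, r, s, β⟩ := v
  change _ = cubicAction ζ C C' (⁅x, y⁆ + θ t k - θ u f, ⁅x, u⁆ - ⁅y, t⁆, ⁅x, k⁆ - ⁅y, f⁆) _ + _
  refine CubicModule.ext_of_dual ?_ (fun g => ?_) (fun w => ?_) ?_ <;>
    simp only [cubicAction_apply, Prod.fst_add, Prod.snd_add, map_add, map_sub, map_smul,
      smul_eq_mul, LinearMap.add_apply, LinearMap.sub_apply, LinearMap.smul_apply, lie_add, lie_sub,
      lie_smul, add_lie, sub_lie, lie_lie, Module.Dual.lie_apply, CubicForm.apply_contractDual,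
      CubicForm.apply_lie_contractDual, CubicForm.toFun_contractDual, h.map_lie, h.map_pairing]
  · rw [C'.symm_left k s f, C'.symm_left f s k, C'.symm_right s f k]
    ring
  · linear_combination C'.symm_left f (C.toFun u r) g - C'.symm_left k (C.toFun t r) g
      + 3 * β * C'.symm_left f k g + h.isDualTrilinear u r f g - h.isDualTrilinear t r k g
      - h.lie_right x k s g + h.lie_right y f s g
  · linear_combination 3 * α * C.symm_left t u w + h.isDualTrilinear t w k s
      - h.isDualTrilinear u w f s - h.lie_left x u r w + h.lie_left y t r w
  · rw [C.symm_right u r t, C.symm_left u t r, C.symm_right t u r]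
    ring

variable (hθ) in
/-- The module structure on `ℂ ⊕ W ⊕ W* ⊕ ℂ` over the graded Lie algebra `L ⊕ W ⊕ W*`. -/
@[reducible]
def lieRingModule : LieRingModule (GradedLie θ hθ) (CubicModule W) where
  bracket a v := cubicAction ζ C C' a v
  add_lie a b v := LinearMap.map_add₂ (cubicAction ζ C C') a b v
  lie_add a v w := map_add (cubicAction ζ C C' a) v w
  leibniz_lie := h.cubicAction_leibniz hθ

variable (hθ) in
theorem lieModule :
    letI := h.lieRingModule hθ
    LieModule ℂ (GradedLie θ hθ) (CubicModule W) :=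
  letI := h.lieRingModule hθ
  { smul_lie c a v := LinearMap.map_smul₂ (cubicAction ζ C C') c a v
    lie_smul c a v := map_smul (cubicAction ζ C C' a) c v }

variable (hθ) in
theorem isCubicAction {z : L} (hz : z ∈ LieAlgebra.center ℂ L) (hzW : ∀ w : W, ⁅z, w⁆ = w)
    (hζz : ζ z = 1) :
    letI := h.lieRingModule hθ
    IsCubicAction θ hθ C C' :=
  letI := h.lieRingModule hθ
  { derived_act x hx a r s b := by
      change cubicAction ζ C C' (x, 0, 0) _ = _
      simp [cubicAction_mk_zero_zero, h.apply_eq_zero_of_mem_derivedIdeal hx]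
    center_act := by
      refine ⟨z, hz, hzW, fun a r s b => ?_⟩
      change cubicAction ζ C C' (z, 0, 0) _ = _
      rw [cubicAction_mk_zero_zero, hζz, hzW, dual_lie_eq_neg_of_lie_eq_self hzW]
      refine Prod.ext (by ring) (Prod.ext ?_ (Prod.ext ?_ (by ring))) <;> module
    raise_act t a r s b := cubicAction_raise t _
    lower_act f a r s b := cubicAction_lower f _ }

end IsCubicPair

namespace IsCubicAction

variable [LieRingModule (GradedLie θ hθ) (CubicModule W)] (h : IsCubicAction θ hθ C C')
  {N : LieSubmodule ℂ (GradedLie θ hθ) (CubicModule W)}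
include h

theorem raise_mem (t : W) {a : ℂ} {r : W} {s : Module.Dual ℂ W} {b : ℂ} (hv : (a, r, s, b) ∈ N) :
    (0, (3 * a) • t, C.toFun t r, 1 / 2 * s t) ∈ N :=
  h.raise_act t a r s b ▸ N.lie_mem hv

theorem lower_mem (f : Module.Dual ℂ W) {a : ℂ} {r : W} {s : Module.Dual ℂ W} {b : ℂ}
    (hv : (a, r, s, b) ∈ N) :
    (1 / 2 * f r, C'.contractDual f s, (3 * b) • f, 0) ∈ N :=
  h.lower_act f a r s b ▸ N.lie_mem hv

theorem eq_top_of_lowest_mem (hC : C.toFun ≠ 0) {a : ℂ} (ha : a ≠ 0) (hv : (a, 0, 0, 0) ∈ N) :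
    N = ⊤ := by
  have lowest_mem (c : ℂ) : (c, 0, 0, 0) ∈ N := by simpa [ha] using N.smul_mem (c / a) hv
  have primal_mem (r : W) : (0, r, 0, 0) ∈ N := by
    simpa using h.raise_mem r (lowest_mem (1 / 3))
  obtain ⟨t, r, w, apply_ne⟩ : ∃ t r w, C.toFun t r w ≠ 0 := by
    by_contra! C_eq_zero
    exact hC (LinearMap.ext₂ fun t r => LinearMap.ext (C_eq_zero t r))
  have highest_mem (c : ℂ) : (0, 0, 0, c) ∈ N := by
    have toFun_mem : (0, 0, C.toFun t r, 0) ∈ N := by simpa using h.raise_mem t (primal_mem r)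
    have apply_mem : (0, 0, 0, 1 / 2 * C.toFun t r w) ∈ N := by
      simpa using h.raise_mem w toFun_mem
    have c_eq : 2 * c / C.toFun t r w * (1 / 2 * C.toFun t r w) = c := by field_simp
    simpa only [Prod.smul_mk, smul_eq_mul, mul_zero, smul_zero, c_eq,
      LieSubmodule.mem_toSubmodule] using
      N.smul_mem (2 * c / C.toFun t r w) apply_mem
  have dual_mem (s : Module.Dual ℂ W) : (0, 0, s, 0) ∈ N := by
    simpa using h.lower_mem s (highest_mem (1 / 3))
  refine eq_top_iff.mpr fun ⟨a, r, s, b⟩ _ => ?_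
  simpa using N.add_mem (N.add_mem (lowest_mem a) (primal_mem r))
    (N.add_mem (dual_mem s) (highest_mem b))

theorem eq_top_of_primal_mem (hC : C.toFun ≠ 0) {r : W} (hr : r ≠ 0) (hv : (0, r, 0, 0) ∈ N) :
    N = ⊤ := by
  obtain ⟨f, hf⟩ := Module.Projective.exists_dual_ne_zero ℂ hr
  refine h.eq_top_of_lowest_mem hC (a := 1 / 2 * f r) (mul_ne_zero (by norm_num) hf) ?_
  simpa using h.lower_mem f hv

theorem eq_top_of_highest_mem (hC : C.toFun ≠ 0) (hC' : C'.toFun ≠ 0) {b : ℂ} (hb : b ≠ 0)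
    (hv : (0, 0, 0, b) ∈ N) : N = ⊤ := by
  obtain ⟨f, s, g, apply_ne⟩ : ∃ f s g, C'.toFun f s g ≠ 0 := by
    by_contra! C'_eq_zero
    exact hC' (LinearMap.ext₂ fun f s => LinearMap.ext (C'_eq_zero f s))
  have dual_mem : (0, 0, s, 0) ∈ N := by
    have three_mul_ne : 3 * b ≠ 0 := mul_ne_zero three_ne_zero hb
    simpa [-mul_inv_rev, smul_smul, inv_mul_cancel₀ three_mul_ne] using
      N.smul_mem (3 * b)⁻¹ (h.lower_mem s hv)
  have contractDual_ne : C'.contractDual f s ≠ 0 := fun contractDual_eq => apply_ne (by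
    rw [← CubicForm.apply_contractDual, contractDual_eq, map_zero])
  exact h.eq_top_of_primal_mem hC contractDual_ne (by simpa using h.lower_mem f dual_mem)

theorem eq_top_of_dual_mem (hC : C.toFun ≠ 0) (hC' : C'.toFun ≠ 0) {s : Module.Dual ℂ W}
    (hs : s ≠ 0) (hv : (0, 0, s, 0) ∈ N) : N = ⊤ := by
  obtain ⟨w, hw⟩ := DFunLike.ne_iff.mp hs
  refine h.eq_top_of_highest_mem hC hC' (b := 1 / 2 * s w) (mul_ne_zero (by norm_num) hw) ?_
  simpa using h.raise_mem w hv

theorem isIrreducible [LieModule ℂ (GradedLie θ hθ) (CubicModule W)] (hC : C.toFun ≠ 0)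
    (hC' : C'.toFun ≠ 0) : LieModule.IsIrreducible ℂ (GradedLie θ hθ) (CubicModule W) := by
  refine LieModule.IsIrreducible.mk fun N hN => ?_
  obtain ⟨z, -, -, z_lie⟩ := h.center_act
  obtain ⟨c, ⟨a, r, s, b⟩, hv, hv_ne, z_lie_v⟩ :=
    exists_mem_ne_zero_lie_eq_smul hN (GradedLie.mk θ hθ z 0 0)
  rw [z_lie] at z_lie_v
  obtain ⟨ha, hr, hs, hb⟩ : -(3 / 2) * a = c * a ∧ -(1 / 2 : ℂ) • r = c • r ∧
      (1 / 2 : ℂ) • s = c • s ∧ 3 / 2 * b = c * b := by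
    simpa only [Prod.smul_mk, Prod.mk.injEq, smul_eq_mul] using z_lie_v
  have a_or : -(3 / 2) = c ∨ a = 0 := mul_eq_mul_right_iff.mp ha
  have r_or : -(1 / 2) = c ∨ r = 0 := or_iff_not_imp_right.mpr (smul_left_injective ℂ · hr)
  have s_or : 1 / 2 = c ∨ s = 0 := or_iff_not_imp_right.mpr (smul_left_injective ℂ · hs)
  have b_or : 3 / 2 = c ∨ b = 0 := mul_eq_mul_right_iff.mp hb
  have homogeneous : a ≠ 0 ∧ r = 0 ∧ s = 0 ∧ b = 0 ∨ a = 0 ∧ r ≠ 0 ∧ s = 0 ∧ b = 0 ∨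
      a = 0 ∧ r = 0 ∧ s ≠ 0 ∧ b = 0 ∨ a = 0 ∧ r = 0 ∧ s = 0 ∧ b ≠ 0 := by
    simp only [ne_eq, Prod.mk_eq_zero] at hv_ne
    grind
  rcases homogeneous with ⟨ha, rfl, rfl, rfl⟩ | ⟨rfl, hr, rfl, rfl⟩ | ⟨rfl, rfl, hs, rfl⟩ |
    ⟨rfl, rfl, rfl, hb⟩
  · exact h.eq_top_of_lowest_mem hC ha hv
  · exact h.eq_top_of_primal_mem hC hr hv
  · exact h.eq_top_of_dual_mem hC hC' hs hv
  · exact h.eq_top_of_highest_mem hC hC' hb hv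

end IsCubicAction

end CubicModule

namespace GradedLie

variable {L W : Type*} [LieRing L] [LieAlgebra ℂ L] [AddCommGroup W] [Module ℂ W]
  [LieRingModule L W] [LieModule ℂ L W] {θ : W →ₗ[ℂ] Module.Dual ℂ W →ₗ[ℂ] L}
  {hθ : IsLiePairing θ}

instance [Module.Finite ℂ L] [Module.Finite ℂ W] : Module.Finite ℂ (GradedLie θ hθ) :=
  inferInstanceAs (Module.Finite ℂ (L × W × Module.Dual ℂ W))

theorem mk_lie_mk (x y : L) (u v : W) (f g : Module.Dual ℂ W) :
    ⁅mk θ hθ x u f, mk θ hθ y v g⁆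
      = mk θ hθ (⁅x, y⁆ + θ u g - θ v f) (⁅x, v⁆ - ⁅y, u⁆) (⁅x, g⁆ - ⁅y, f⁆) := rfl

theorem mk_add_mk (x y : L) (u v : W) (f g : Module.Dual ℂ W) :
    mk θ hθ x u f + mk θ hθ y v g = mk θ hθ (x + y) (u + v) (f + g) := rfl

theorem smul_mk (c : ℂ) (x : L) (u : W) (f : Module.Dual ℂ W) :
    c • mk θ hθ x u f = mk θ hθ (c • x) (c • u) (c • f) := rfl

theorem mk_zero : mk θ hθ 0 0 0 = 0 := rfl

theorem mk_inj {x y : L} {u v : W} {f g : Module.Dual ℂ W} :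
    mk θ hθ x u f = mk θ hθ y v g ↔ x = y ∧ u = v ∧ f = g := by
  unfold mk
  exact Prod.mk_inj.trans (and_congr_right' Prod.mk_inj)

variable {I : LieIdeal ℂ (GradedLie θ hθ)}

/-- The elements of `W` lying in an ideal of `L ⊕ W ⊕ W*`. -/
def primalPart (I : LieIdeal ℂ (GradedLie θ hθ)) : LieSubmodule ℂ L W where
  carrier := {u | mk θ hθ 0 u 0 ∈ I}
  add_mem' hu hv := by simpa [mk_add_mk] using I.add_mem hu hv
  zero_mem' := I.zero_mem
  smul_mem' c u hu := by simpa [smul_mk] using I.smul_mem c hu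
  lie_mem {x u} hu := by
    simpa [mk_lie_mk] using lie_mem_right ℂ (GradedLie θ hθ) I (mk θ hθ x 0 0) _ hu

/-- The elements of `L` lying in an ideal of `L ⊕ W ⊕ W*`. -/
def basePart (I : LieIdeal ℂ (GradedLie θ hθ)) : Submodule ℂ L where
  carrier := {x | mk θ hθ x 0 0 ∈ I}
  add_mem' hx hy := by simpa [mk_add_mk] using I.add_mem hx hy
  zero_mem' := I.zero_mem
  smul_mem' c x hx := by simpa [smul_mk] using I.smul_mem c hx

theorem map_mem_basePart (hI : primalPart I = ⊤) (u : W) (f : Module.Dual ℂ W) :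
    θ u f ∈ basePart I := by
  have u_mem : u ∈ primalPart I := hI ▸ LieSubmodule.mem_top u
  change mk θ hθ (θ u f) 0 0 ∈ I
  simpa [mk_lie_mk] using lie_mem_left ℂ (GradedLie θ hθ) I _ (mk θ hθ 0 0 f) u_mem

variable {z : L} (hz : ∀ w : W, ⁅z, w⁆ = w)
include hz

theorem eq_top_of_primalPart_of_basePart (hW : primalPart I = ⊤) (hL : basePart I = ⊤) :
    I = ⊤ := by
  have primal_mem (u : W) : mk θ hθ 0 u 0 ∈ I := by
    change u ∈ primalPart I
    exact hW ▸ LieSubmodule.mem_top u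
  have base_mem (x : L) : mk θ hθ x 0 0 ∈ I := by
    change x ∈ basePart I
    exact hL ▸ Submodule.mem_top
  have dual_mem (f : Module.Dual ℂ W) : mk θ hθ 0 0 f ∈ I := by
    simpa [mk_lie_mk, -lie_neg, dual_lie_eq_neg_of_lie_eq_self hz] using
      lie_mem_left ℂ (GradedLie θ hθ) I _ (mk θ hθ 0 0 (-f)) (base_mem z)
  refine eq_top_iff.mpr fun ⟨x, u, f⟩ _ => ?_
  change mk θ hθ x u f ∈ I
  simpa [mk_add_mk] using I.add_mem (I.add_mem (base_mem x) (primal_mem u)) (dual_mem f)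

variable {K : LinearMap.BilinForm ℂ L}
  (adjoint : ∀ (x : L) (u : W) (f : Module.Dual ℂ W), K x (θ u f) = f ⁅x, u⁆)
include adjoint

omit hz in
theorem eq_top_of_forall_map_mem [LieModule.IsFaithful ℂ L W] [Module.Finite ℂ L]
    (symm : K.IsSymm) (nondeg : K.Nondegenerate) {M : Submodule ℂ L} (hM : ∀ u f, θ u f ∈ M) :
    M = ⊤ := by
  have orthogonal_eq : K.orthogonal M = ⊥ := by
    refine (Submodule.eq_bot_iff _).mpr fun x hx => ?_
    refine LieModule.ext_of_isFaithful (R := ℂ) (M := W) fun u => ?_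
    rw [zero_lie]
    refine (Module.forall_dual_apply_eq_zero_iff ℂ _).mp fun f => ?_
    rw [← adjoint, symm.eq]
    exact hx _ (hM u f)
  rw [← LinearMap.BilinForm.orthogonal_orthogonal nondeg symm.isRefl M, orthogonal_eq]
  exact LinearMap.BilinForm.orthogonal_bot

variable [LieModule.IsIrreducible ℂ L W] [LieModule.IsFaithful ℂ L W] [Module.Finite ℂ L]
  (symm : K.IsSymm) (nondeg : K.Nondegenerate)
include symm nondeg

theorem eq_top_of_primal_mem {u : W} (hu : u ≠ 0) (hmem : mk θ hθ 0 u 0 ∈ I) : I = ⊤ := by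
  have primalPart_ne : primalPart I ≠ ⊥ := fun primalPart_eq =>
    hu ((LieSubmodule.eq_bot_iff _).mp primalPart_eq u hmem)
  have primalPart_eq : primalPart I = ⊤ := (eq_bot_or_eq_top _).resolve_left primalPart_ne
  exact eq_top_of_primalPart_of_basePart hz primalPart_eq
    (eq_top_of_forall_map_mem adjoint symm nondeg (map_mem_basePart primalPart_eq))

theorem eq_top_of_base_mem {x : L} (hx : x ≠ 0) (hmem : mk θ hθ x 0 0 ∈ I) : I = ⊤ := by
  obtain ⟨u, hu⟩ : ∃ u : W, ⁅x, u⁆ ≠ 0 := by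
    by_contra! lie_eq
    exact hx (LieModule.ext_of_isFaithful (R := ℂ) (M := W) fun u => by rw [lie_eq, zero_lie])
  refine eq_top_of_primal_mem hz adjoint symm nondeg hu ?_
  simpa [mk_lie_mk] using lie_mem_left ℂ (GradedLie θ hθ) I _ (mk θ hθ 0 u 0) hmem

theorem eq_top_of_dual_mem {f : Module.Dual ℂ W} (hf : f ≠ 0) (hmem : mk θ hθ 0 0 f ∈ I) :
    I = ⊤ := by
  obtain ⟨u, hu⟩ := DFunLike.ne_iff.mp hf
  have map_ne : θ u f ≠ 0 := fun map_eq => hu (by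
    rw [← hz u, ← adjoint, map_eq, map_zero, LinearMap.zero_apply])
  refine eq_top_of_base_mem hz adjoint symm nondeg map_ne ?_
  simpa [mk_lie_mk] using lie_mem_right ℂ (GradedLie θ hθ) I (mk θ hθ 0 u 0) _ hmem

theorem eq_bot_or_eq_top [Module.Finite ℂ W] (I : LieIdeal ℂ (GradedLie θ hθ)) :
    I = ⊥ ∨ I = ⊤ := by
  refine or_iff_not_imp_left.mpr fun hI => ?_
  obtain ⟨c, ⟨x, u, f⟩, hmem, hne, z_lie⟩ :=
    exists_mem_ne_zero_lie_eq_smul hI (mk θ hθ z 0 0)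
  obtain ⟨hx, hu, hf⟩ : 0 = c • x ∧ (1 : ℂ) • u = c • u ∧ (-1 : ℂ) • f = c • f := by
    refine mk_inj.mp (Eq.trans ?_ z_lie)
    change _ = ⁅mk θ hθ z 0 0, mk θ hθ x u f⁆
    simp [mk_lie_mk, hz, dual_lie_eq_neg_of_lie_eq_self hz, lie_eq_zero_of_lie_eq_self ℂ hz]
  have x_or : c = 0 ∨ x = 0 := smul_eq_zero.mp hx.symm
  have u_or : 1 = c ∨ u = 0 := or_iff_not_imp_right.mpr (smul_left_injective ℂ · hu)
  have f_or : -1 = c ∨ f = 0 := or_iff_not_imp_right.mpr (smul_left_injective ℂ · hf)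
  have homogeneous : x ≠ 0 ∧ u = 0 ∧ f = 0 ∨ x = 0 ∧ u ≠ 0 ∧ f = 0 ∨ x = 0 ∧ u = 0 ∧ f ≠ 0 := by
    have components_ne : ¬(x = 0 ∧ u = 0 ∧ f = 0) := by
      rintro ⟨rfl, rfl, rfl⟩
      exact hne rfl
    grind
  rcases homogeneous with ⟨hx, rfl, rfl⟩ | ⟨rfl, hu, rfl⟩ | ⟨rfl, rfl, hf⟩
  · exact eq_top_of_base_mem hz adjoint symm nondeg hx hmem
  · exact eq_top_of_primal_mem hz adjoint symm nondeg hu hmem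
  · exact eq_top_of_dual_mem hz adjoint symm nondeg hf hmem

theorem isSimple [Module.Finite ℂ W] : LieAlgebra.IsSimple ℂ (GradedLie θ hθ) where
  eq_bot_or_eq_top := eq_bot_or_eq_top hz adjoint symm nondeg
  non_abelian abelian := by
    have : Nontrivial W := LieModule.nontrivial_of_isIrreducible ℂ L W
    obtain ⟨u, hu⟩ := exists_ne (0 : W)
    have lie_eq : mk θ hθ 0 u 0 = mk θ hθ 0 0 0 := by
      simpa [mk_lie_mk, hz, mk_zero] using abelian.trivial (mk θ hθ z 0 0) (mk θ hθ 0 u 0)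
    exact hu (mk_inj.mp lie_eq).2.1

end GradedLie

end

theorem mainTheorem3 {L W : Type*} [LieRing L] [LieAlgebra ℂ L] [Module.Finite ℂ L]
    [AddCommGroup W] [Module ℂ W] [Module.Finite ℂ W] [LieRingModule L W] [LieModule ℂ L W]
    (hred : LieAlgebra.HasCentralRadical ℂ L)
    (hcenter : Module.finrank ℂ (LieAlgebra.center ℂ L) = 1)
    (hirr : LieModule.IsIrreducible ℂ L W)
    (hfaith : LieModule.IsFaithful ℂ L W)
    (hnontriv : ∃ z ∈ LieAlgebra.center ℂ L, ∃ w : W, ⁅z, w⁆ ≠ 0)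
    (halt : altSquare ℂ L W = ⊥ ∨ LieModule.IsIrreducible ℂ L (altSquare ℂ L W))
    (C : CubicForm W) (hC : C.toFun ≠ 0) (hCinv : C.IsInvariant (derivedIdeal L))
    (P S : LieSubmodule ℂ (derivedIdeal L) (symSquare ℂ (derivedIdeal L) W))
    (hPS : IsCompl P S)
    (hP : Nonempty (P ≃ₗ⁅ℂ, derivedIdeal L⁆ Module.Dual ℂ W))
    (hS : S = ⊥ ∨ LieModule.IsIrreducible ℂ (derivedIdeal L) S) :
    ∃ (K : LinearMap.BilinForm ℂ L) (θ : W →ₗ[ℂ] Module.Dual ℂ W →ₗ[ℂ] L)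
      (hθ : IsLiePairing θ),
      K.IsSymm ∧ K.Nondegenerate ∧ (∀ x y z : L, K ⁅x, y⁆ z = K x ⁅y, z⁆) ∧
      (∀ (x : L) (u : W) (f : Module.Dual ℂ W), K x (θ u f) = f ⁅x, u⁆) ∧
      LieAlgebra.IsSimple ℂ (GradedLie θ hθ) ∧
      ∃ C' : CubicForm (Module.Dual ℂ W), C'.toFun ≠ 0 ∧ C'.IsInvariant (derivedIdeal L) ∧
        ∃ (_ : LieRingModule (GradedLie θ hθ) (ℂ × W × Module.Dual ℂ W × ℂ))
          (_ : LieModule ℂ (GradedLie θ hθ) (ℂ × W × Module.Dual ℂ W × ℂ)),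
          IsCubicAction θ hθ C C' ∧
          LieModule.IsIrreducible ℂ (GradedLie θ hθ) (ℂ × W × Module.Dual ℂ W × ℂ) := by
  obtain ⟨e⟩ := hP
  obtain ⟨K, z, b, b', h⟩ := exists_isNormalizedForm hcenter hnontriv
  have hθ : IsLiePairing (dualPairing ℂ W b b') := h.isLiePairing halt
  have adjoint := h.isDualPair.apply_dualPairing (M := W)
  have invariant (x y t : L) : K ⁅x, y⁆ t = K x ⁅y, t⁆ := by
    rw [← lie_skew, map_neg, LinearMap.neg_apply, h.lieInvariant, neg_neg]
  obtain ⟨C', hC', hC'inv, dual⟩ := h.exists_isDualTrilinear hθ hC hCinv fun t ht =>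
    h.splitCasimir_eq_of_contract_eq_zero hPS e hS halt hC hCinv ht
  have pair : IsCubicPair (dualPairing ℂ W b b') (K z) C C' := h.isCubicPair hCinv hC'inv dual
  refine ⟨K, dualPairing ℂ W b b', hθ, h.isSymm, h.nondegenerate, invariant, adjoint,
    GradedLie.isSimple h.lie_eq_self adjoint h.isSymm h.nondegenerate, C', hC', hC'inv,
    pair.lieRingModule hθ, pair.lieModule hθ, ?_⟩
  let _ := pair.lieRingModule hθ
  have := pair.lieModule hθ
  have action : IsCubicAction (dualPairing ℂ W b b') hθ C C' :=
    pair.isCubicAction hθ h.mem_center h.lie_eq_self h.apply_self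
  exact ⟨action, action.isIrreducible hC hC'⟩
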